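/- For a vector $|\psi\rangle\in(\mathbb C^2)^{\otimes 4}$ (qubits $A,B,C,D$) and a pair $X,Y$ of the qubits let $\rho_{XY}=\mathrm{tr}_{ZW}|\psi\rangle\langle\psi|$ be the reduced density matrix obtained by tracing out the other two qubits, let $E_{XY}=-\mathrm{tr}(\rho_{XY}\log_2\rho_{XY})$ (with $0\log_2 0=0$), and let $$E_2(\psi)=\tfrac16\,(E_{AB}+E_{AC}+E_{AD}+E_{BC}+E_{BD}+E_{CD}).$$ Let $$|M_4\rangle=\tfrac1{\sqrt6}\bigl[|0011\rangle+|1100\rangle+\omega(|0101\rangle+|1010\rangle)+\bar\omega(|0110\rangle+|1001\rangle)\bigr],\qquad \omega=e^{2\pi i/3}.$$ A normalised variation of $|M_4\rangle$ is a pair of vectors $|\delta\psi\rangle,|\delta^2\psi\rangle\in(\mathbb C^2)^{\otimes4}$ such that $2\,\mathrm{Re}\langle\delta\psi|M_4\rangle=0$ and $2\,\mathrm{Re}\langle\delta^2\psi|M_4\rangle+\langle\delta\psi|\delta\psi\rangle=0$. The vector $|\delta\psi\rangle$ is an infinitesimal local unitary transformation of $|M_4\rangle$ if $|\delta\psi\rangle=i\,(H_A+H_B+H_C+H_D)|M_4\rangle$,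 where $H_X$ is a Hermitian $2\times2$ matrix acting on qubit $X$ (and as the identity on the other qubits). The first and second variations of $E_2$ are the real numbers $\delta E_2$ and $\delta^2E_2$ such that, for every path with $\psi(t)=M_4+t\,\delta\psi+t^2\,\delta^2\psi+o(t^2)$ as $t\to0$, $$E_2(\psi(t))=E_2(M_4)+t\,\delta E_2+t^2\,\delta^2E_2+o(t^2).$$ Then $|M_4\rangle$ is a unit vector. For every normalised variation of $|M_4\rangle$ for which $|\delta\psi\rangle$ is not an infinitesimal local unitary transformation of $|M_4\rangle$, the first and second variations of $E_2$ exist, $\delta E_2=0$, and $\delta^2E_2<0$. Moreover, $|M_4\rangle$ is a local maximum of $E_2$ among four-qubit pure states: there is a neighbourhood of $|M_4\rangle$ in the unit sphere of $(\mathbb C^2)^{\otimes4}$ on which $E_2\le E_2(M_4)$. -/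

import Mathlib

open scoped Topology

noncomputable section

namespace FourQubit

/-- The Hilbert space `(ℂ²)^{⊗4}` of four qubits, in the computational basis: the qubits
`A, B, C, D` are numbered `0, 1, 2, 3`, and `ψ b` is the amplitude of `|b₀ b₁ b₂ b₃⟩`. -/
abbrev State : Type := EuclideanSpace ℂ (Fin 4 → Fin 2)

/-- The computational basis vector `|i j k l⟩`. -/
def ket (i j k l : Fin 2) : State := EuclideanSpace.single ![i, j, k, l] (1 : ℂ)

/-- `ω = exp (2πi/3)`. -/
def omega : ℂ := Complex.exp (2 * Real.pi * Complex.I / 3)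

/-- The state `|M₄⟩`. -/
def M4 : State :=
  ((1 / Real.sqrt 6 : ℝ) : ℂ) •
    (ket 0 0 1 1 + ket 1 1 0 0
      + omega • (ket 0 1 0 1 + ket 1 0 1 0)
      + (starRingEnd ℂ omega) • (ket 0 1 1 0 + ket 1 0 0 1))

/-- The basis label that equals `a` on the qubits in `S` and `c` on the other qubits. -/
def glue (S : Finset (Fin 4)) (a : {q // q ∈ S} → Fin 2) (c : {q // q ∉ S} → Fin 2) :
    Fin 4 → Fin 2 :=
  fun q => if h : q ∈ S then a ⟨q, h⟩ else c ⟨q, h⟩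

/-- The reduced density matrix `ρ_S` of the qubits in `S`: the partial trace of `|ψ⟩⟨ψ|` over
the qubits outside `S`. -/
def reducedDensity (S : Finset (Fin 4)) (ψ : State) :
    Matrix ({q // q ∈ S} → Fin 2) ({q // q ∈ S} → Fin 2) ℂ :=
  fun a b => ∑ c : {q // q ∉ S} → Fin 2, ψ (glue S a c) * starRingEnd ℂ (ψ (glue S b c))

/-- The von Neumann entropy `-tr (ρ log₂ ρ)` of a Hermitian matrix; `log₂ ρ` is taken in the
continuous functional calculus with `log₂ 0 = 0`, so that `0 log₂ 0 = 0` as usual. -/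
def vonNeumannEntropy {n : Type} [Fintype n] [DecidableEq n] (ρ : Matrix n n ℂ) : ℝ :=
  -(Matrix.trace (ρ * cfc (Real.logb 2) ρ)).re

/-- The average two-qubit entropy
`E₂ = (1/6) (E_AB + E_AC + E_AD + E_BC + E_BD + E_CD)`. -/
def E2 (ψ : State) : ℝ :=
  (1 / 6 : ℝ) * ∑ S ∈ (Finset.univ : Finset (Fin 4)).powersetCard 2,
    vonNeumannEntropy (reducedDensity S ψ)

/-- `δF` and `δ2F` are the first and second variations of `F` at `ψ` for the variation
`ψ ↦ ψ + δψ + δ²ψ`: whenever a path has the second-order approximation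
`ψ + t δψ + t² δ²ψ`, the values of `F` along it have the second-order approximation
`F ψ + t δF + t² δ2F` as `t → 0`. (There are no factors `1/2`.) The path
`t ↦ ψ + t δψ + t² δ²ψ` itself is included, so `δF` and `δ2F` are unique. -/
def HasVariations (F : State → ℝ) (ψ δψ δ2ψ : State) (δF δ2F : ℝ) : Prop :=
  ∀ γ : ℝ → State,
    (fun t : ℝ => γ t - (ψ + t • δψ + t ^ 2 • δ2ψ)) =o[𝓝 0] (fun t : ℝ => t ^ 2) →
    (fun t : ℝ => F (γ t) - (F ψ + t * δF + t ^ 2 * δ2F)) =o[𝓝 0] (fun t : ℝ => t ^ 2)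

/-- The action of a `2 × 2` matrix on the `k`-th qubit (identity on the others). -/
def applyQubit (k : Fin 4) (H : Matrix (Fin 2) (Fin 2) ℂ) (ψ : State) : State :=
  WithLp.toLp 2 fun b => ∑ s : Fin 2, H (b k) s * ψ (Function.update b k s)

/-- `φ` is an infinitesimal local unitary transformation of `ψ`, i.e. it is the derivative at
`t = 0` of `(exp (i t H₀) ⊗ exp (i t H₁) ⊗ exp (i t H₂) ⊗ exp (i t H₃)) ψ` for some Hermitian
`2 × 2` matrices `H₀, H₁, H₂, H₃`. (An overall change of phase is the case of scalar `H`.) -/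
def IsInfinitesimalLocalUnitary (ψ φ : State) : Prop :=
  ∃ H : Fin 4 → Matrix (Fin 2) (Fin 2) ℂ,
    (∀ k, (H k).IsHermitian) ∧ φ = Complex.I • ∑ k, applyQubit k (H k) ψ

end FourQubit

end

/-! Complementary pairs have equal entropy, so `E2` is a third of a sum over three bipartitions
("cuts") of the entropy of `V * Vᴴ`, with `V` the amplitude matrix. At `M4` each cut gives 1/6 +
P/3, with P the singlet projector, hence spectrum 1/2, 1/6, 1/6, 1/6. To expand the entropy without
differentiating an operator logarithm, -x log x is replaced by its quintic Hermite interpolant at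
1/2 and 1/6. The trace of a polynomial expands algebraically, and the error is cubic in the
perturbation (`entropy_gram_expansion`).

Summed over the cuts, the first-order terms reduce to a multiple of the change of ‖ψ‖²
(`sum_trace_singlet_gramLin`), which is harmless on the sphere. The second-order form `hessian` is
diagonal in total spin (`hessian_eq`): 16 = 2·1 + 3·3 + 1·5, and it is minus a sum of squares with
positive weights because log 3 < 2. Its kernel has real dimension 10 and lies in the tangent space
of the local unitary orbit: nine spin-one directions and the phase (`exists_herm_of_components`).
This gives the strict sign of the second variation.

For the local maximum, `hessian` is uniformly negative on the normal space (`exists_hessian_le`). A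
nearby unit ψ is replaced by the point nearest to `M4` among states with the same cut spectra. This
changes neither `E2` nor the norm, and minimality makes the displacement normal
(`sub_mem_normalSpace`), so no slice theorem is needed. -/

noncomputable section

namespace FourQubit

section

open Polynomial

/-! ### Entropy of a Hermitian matrix through its eigenvalues -/

section Spectral

variable {n : Type} [Fintype n] [DecidableEq n] {A B : Matrix n n ℂ}

lemma trace_cfc (hA : A.IsHermitian) (g : ℝ → ℝ) :
    (cfc g A).trace = ((∑ i, g (hA.eigenvalues i) : ℝ) : ℂ) := by
  rw [hA.cfc_eq, Matrix.IsHermitian.cfc, Unitary.conjStarAlgAut_apply, Matrix.trace_mul_comm,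
    ← mul_assoc]
  simp [Matrix.trace_diagonal]

lemma trace_aeval (hA : A.IsHermitian) (p : ℝ[X]) :
    (aeval A p).trace = ((∑ i, p.eval (hA.eigenvalues i) : ℝ) : ℂ) := by
  rw [← cfc_polynomial p A hA.isSelfAdjoint, trace_cfc hA]

lemma vonNeumannEntropy_eq_sum (hA : A.IsHermitian) :
    vonNeumannEntropy A = (∑ i, Real.negMulLog (hA.eigenvalues i)) / Real.log 2 := by
  -- On a finite spectrum every function is continuous, so the singularity of the logarithm at 0
  -- does not obstruct the functional calculus.
  have hfin : (spectrum ℝ A).Finite := by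
    rw [hA.spectrum_real_eq_range_eigenvalues]; exact Set.finite_range _
  have h : A * cfc (Real.logb 2) A = cfc (fun x : ℝ => x * Real.logb 2 x) A := by
    conv_lhs => enter [1]; rw [← cfc_id' ℝ A hA.isSelfAdjoint]
    exact (cfc_mul _ _ A (hfin.continuousOn _) (hfin.continuousOn _)).symm
  rw [vonNeumannEntropy, h, trace_cfc hA, Complex.ofReal_re, Finset.sum_div,
    ← Finset.sum_neg_distrib]
  refine Finset.sum_congr rfl fun i _ => ?_
  simp only [Real.negMulLog, Real.logb]
  ring

lemma vonNeumannEntropy_congr (hA : A.IsHermitian) (hB : B.IsHermitian)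
    (h : A.charpoly = B.charpoly) : vonNeumannEntropy A = vonNeumannEntropy B := by
  rw [vonNeumannEntropy_eq_sum hA, vonNeumannEntropy_eq_sum hB,
    (Matrix.IsHermitian.eigenvalues_eq_eigenvalues_iff hA hB).2 h]

/-- The eigenvalue families have different index types, so the multisets of characteristic roots are
compared instead. -/
lemma vonNeumannEntropy_reindex {m : Type} [Fintype m] [DecidableEq m] (e : m ≃ n)
    {A : Matrix n n ℂ} (hA : A.IsHermitian) :
    vonNeumannEntropy (A.submatrix e e) = vonNeumannEntropy A := by
  have hB : (A.submatrix e e).IsHermitian := hA.submatrix e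
  have hc : (A.submatrix e e).charpoly = A.charpoly := by
    simpa [Matrix.reindex_apply] using Matrix.charpoly_reindex e.symm A
  have h1 := hA.roots_charpoly_eq_eigenvalues
  have h2 := hB.roots_charpoly_eq_eigenvalues
  rw [hc, h1] at h2
  have h3 := congrArg (fun s : Multiset ℂ => (s.map fun z => Real.negMulLog z.re).sum) h2
  simp only [Multiset.map_map] at h3
  rw [vonNeumannEntropy_eq_sum hA, vonNeumannEntropy_eq_sum hB]
  congr 1
  simpa [Function.comp_def] using h3.symm

end Spectral

/-! ### The Hermite interpolant of `-x log x` at `1/2` and `1/6` -/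

/-- The monic polynomial with the simple roots `1/2` and `1/6`. -/
def nodePoly : ℝ[X] := X ^ 2 - C (2 / 3) * X + C (1 / 12)

/-- The polynomial agreeing with `-x log x` up to second order at `1/2` and `1/6`. -/
def entropyPoly : ℝ[X] :=
  -- Newton form in powers of `nodePoly`: the three linear factors successively match values, first
  -- derivatives and second derivatives at the nodes.
  C (Real.log 3 / 4) + C (Real.log 2 - Real.log 3 / 2) * X
    + nodePoly * (C (6 - 15 / 2 * Real.log 3) + C (18 * Real.log 3 - 18) * X)
    + nodePoly ^ 2 * (C (351 / 2 * Real.log 3 - 198) + C (540 - 486 * Real.log 3) * X)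

lemma abs_quadratic_le {a b c u : ℝ} (hu : |u| ≤ 1 / 2) :
    |a + b * u + c * u ^ 2| ≤ |a| + |b| + |c| := by
  have h1 : |b * u| ≤ |b| := by
    rw [abs_mul]; nlinarith [abs_nonneg b, abs_nonneg u]
  have h2 : |c * u ^ 2| ≤ |c| := by
    rw [abs_mul, abs_pow]
    exact mul_le_of_le_one_right (abs_nonneg c) (pow_le_one₀ (abs_nonneg u) (by linarith))
  calc _ ≤ |a + b * u| + |c * u ^ 2| := abs_add_le _ _
    _ ≤ |a| + |b * u| + |c * u ^ 2| := by gcongr; exact abs_add_le _ _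
    _ ≤ _ := by gcongr

lemma abs_log_one_add_sub_le {u : ℝ} (hu : |u| ≤ 1 / 2) :
    |Real.log (1 + u) - (u - u ^ 2 / 2)| ≤ 2 * |u| ^ 3 := by
  have h := Real.abs_log_sub_add_sum_range_le (x := -u) (by rw [abs_neg]; linarith) 2
  rw [abs_neg, sub_neg_eq_add] at h
  have e : (∑ i ∈ Finset.range 2, (-u) ^ (i + 1) / ((i : ℝ) + 1)) + Real.log (1 + u)
      = Real.log (1 + u) - (u - u ^ 2 / 2) := by
    simp [Finset.sum_range_succ]; ring
  rw [e] at h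
  refine h.trans ?_
  rw [div_le_iff₀ (by linarith)]
  have h3 : 0 ≤ |u| ^ 3 * (1 - 2 * |u|) :=
    mul_nonneg (pow_nonneg (abs_nonneg u) 3) (by linarith)
  calc |u| ^ (2 + 1) = 2 * |u| ^ 3 * (1 - |u|) - |u| ^ 3 * (1 - 2 * |u|) := by ring
    _ ≤ _ := by linarith

/-- A function that is cubically small in the relative displacement `u` from a node at which
`nodePoly` has a simple root is cubically small in `nodePoly`. -/
lemma abs_le_cube_of_local {h q x u a b c : ℝ} (hu : |u| ≤ 1 / 2) (hx : |x| ≤ 1)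
    (hq : |u| ≤ 24 * |q|)
    (hh : h = -x * (Real.log (1 + u) - (u - u ^ 2 / 2)) + u ^ 3 * (a + b * u + c * u ^ 2)) :
    |h| ≤ (2 + (|a| + |b| + |c|)) * 24 ^ 3 * |q| ^ 3 := by
  have h1 := abs_log_one_add_sub_le hu
  have h2 := abs_quadratic_le (a := a) (b := b) (c := c) hu
  have h3 : |u| ^ 3 ≤ (24 * |q|) ^ 3 := by gcongr
  calc |h| ≤ |-x * (Real.log (1 + u) - (u - u ^ 2 / 2))| + |u ^ 3 * (a + b * u + c * u ^ 2)| := by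
        rw [hh]; exact abs_add_le _ _
    _ ≤ 1 * (2 * |u| ^ 3) + |u| ^ 3 * (|a| + |b| + |c|) := by
        rw [abs_mul, abs_mul, abs_neg, abs_pow]; gcongr
    _ = (2 + (|a| + |b| + |c|)) * |u| ^ 3 := by ring
    _ ≤ (2 + (|a| + |b| + |c|)) * (24 * |q|) ^ 3 := by gcongr
    _ = _ := by ring

lemma exists_abs_negMulLog_sub_entropyPoly_le :
    ∃ K : ℝ, 0 < K ∧ ∀ x : ℝ, |nodePoly.eval x| ≤ 1 / 48 →
      |Real.negMulLog x - entropyPoly.eval x| ≤ K * |nodePoly.eval x| ^ 3 := by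
  set B := Real.log 3 with hB
  -- Coefficients `a, b, c` for `abs_le_cube_of_local` at the node `l`, with u = x/l - 1. Here `r`
  -- is the value at `l` of the linear factor of `nodePoly ^ 2`, and `s` is the sign of the
  -- derivative of `nodePoly` at `l`.
  let f (l r s : ℝ) : ℝ × ℝ × ℝ :=
    (l / 2 - l ^ 3 * ((18 * B - 18) + (540 - 486 * B) / 9 + s * 2 * r / 3),
      - l ^ 4 * (r + s * 2 * (540 - 486 * B) / 3), - l ^ 5 * (540 - 486 * B))
  let y := f (1 / 2) (72 - 135 / 2 * B) 1
  let z := f (1 / 6) (189 / 2 * B - 108) (-1)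
  have l2 : Real.log (1 / 2) = - Real.log 2 := by rw [one_div, Real.log_inv]
  have l6 : Real.log (1 / 6) = - Real.log 2 - B := by
    rw [one_div, Real.log_inv, show (6 : ℝ) = 2 * 3 by norm_num,
      Real.log_mul (by norm_num) (by norm_num)]; ring
  have hev : ∀ x : ℝ, nodePoly.eval x = (x - 1 / 2) * (x - 1 / 6) := fun x => by
    simp only [nodePoly, eval_add, eval_sub, eval_pow, eval_mul, eval_X, eval_C]; ring
  refine ⟨(2 + (|y.1| + |y.2.1| + |y.2.2|)) * 24 ^ 3 + (2 + (|z.1| + |z.2.1| + |z.2.2|)) * 24 ^ 3,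
    by positivity, fun x hx => ?_⟩
  rw [add_mul]
  -- In each window the relative displacement is at most 1/2; outside both, |`nodePoly`| would
  -- exceed 1/4 · 1/12 = 1/48.
  rcases le_or_gt |x - 1 / 2| (1 / 4) with h1 | h1
  · refine le_add_of_le_of_nonneg ?_ (by positivity)
    have h1' := abs_le.1 h1
    refine abs_le_cube_of_local (u := 2 * x - 1) (x := x) ?_ ?_ ?_ ?_
    · rw [abs_le]; constructor <;> linarith
    · rw [abs_le]; constructor <;> linarith
    · rw [hev, abs_mul, abs_of_pos (show (0 : ℝ) < x - 1 / 6 by linarith),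
        show (2 * x - 1) = 2 * (x - 1 / 2) by ring, abs_mul, abs_two]
      nlinarith [abs_nonneg (x - 1 / 2)]
    · have hl : Real.log x = Real.log (1 + (2 * x - 1)) - Real.log 2 := by
        rw [← Real.log_div (by linarith) (by norm_num)]; congr 1; ring
      simp only [Real.negMulLog, hl, entropyPoly, nodePoly, eval_add, eval_sub, eval_pow, eval_mul,
        eval_X, eval_C, y, f, ← hB]
      ring
  · rcases le_or_gt |x - 1 / 6| (1 / 12) with h2 | h2
    · refine le_add_of_nonneg_of_le (by positivity) ?_
      have h2' := abs_le.1 h2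
      refine abs_le_cube_of_local (u := 6 * x - 1) (x := x) ?_ ?_ ?_ ?_
      · rw [abs_le]; constructor <;> linarith
      · rw [abs_le]; constructor <;> linarith
      · rw [hev, abs_mul, abs_of_neg (show x - 1 / 2 < 0 by linarith),
          show (6 * x - 1) = 6 * (x - 1 / 6) by ring, abs_mul, abs_of_pos (by norm_num : (0:ℝ) < 6)]
        nlinarith [abs_nonneg (x - 1 / 6)]
      · have hl : Real.log x = Real.log (1 + (6 * x - 1)) - Real.log 2 - B := by
          rw [hB, sub_sub, ← Real.log_mul (by norm_num) (by norm_num),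
            ← Real.log_div (by linarith) (by norm_num)]; congr 1; ring
        simp only [Real.negMulLog, hl, entropyPoly, nodePoly, eval_add, eval_sub, eval_pow,
          eval_mul, eval_X, eval_C, z, f, ← hB]
        ring
    · rw [hev, abs_mul] at hx
      nlinarith [mul_lt_mul'' h1 h2 (by norm_num) (by norm_num)]

/-- The entropy of a matrix that is nearly a root of `nodePoly`. -/
lemma exists_abs_entropy_sub_trace_le {n : Type} [Fintype n] [DecidableEq n] :
    ∃ K : ℝ, 0 < K ∧ ∀ A : Matrix n n ℂ, A.IsHermitian →
      (aeval A (nodePoly ^ 2)).trace.re ≤ (1 / 48) ^ 2 →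
      |vonNeumannEntropy A * Real.log 2 - (aeval A entropyPoly).trace.re| ≤
        K * √((aeval A (nodePoly ^ 2)).trace.re) ^ 3 := by
  obtain ⟨K, hK, h⟩ := exists_abs_negMulLog_sub_entropyPoly_le
  refine ⟨K, hK, fun A hA ht => ?_⟩
  have hl2 : Real.log 2 ≠ 0 := (Real.log_pos (by norm_num)).ne'
  rw [trace_aeval hA, Complex.ofReal_re] at ht ⊢
  rw [trace_aeval hA, Complex.ofReal_re, vonNeumannEntropy_eq_sum hA, div_mul_cancel₀ _ hl2,
    ← Finset.sum_sub_distrib]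
  simp only [eval_pow] at ht ⊢
  set t := ∑ i, eval (hA.eigenvalues i) nodePoly ^ 2 with ht'
  have ht0 : 0 ≤ t := Finset.sum_nonneg fun i _ => sq_nonneg _
  have hi : ∀ i, |eval (hA.eigenvalues i) nodePoly| ≤ √t := fun i => by
    rw [← Real.sqrt_sq_eq_abs]
    exact Real.sqrt_le_sqrt
      (Finset.single_le_sum (f := fun i => eval (hA.eigenvalues i) nodePoly ^ 2)
        (fun i _ => sq_nonneg _) (Finset.mem_univ i))
  have hs : √t ≤ 1 / 48 := Real.sqrt_le_iff.2 ⟨by norm_num, ht⟩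
  calc _ ≤ ∑ i, |Real.negMulLog (hA.eigenvalues i) - eval (hA.eigenvalues i) entropyPoly| :=
        Finset.abs_sum_le_sum_abs _ _
    -- One factor of each cube is bounded by √t; the remaining squares sum to t.
    _ ≤ ∑ i, K * √t * eval (hA.eigenvalues i) nodePoly ^ 2 := by
        refine Finset.sum_le_sum fun i _ => (h _ ((hi i).trans hs)).trans ?_
        rw [pow_succ', sq_abs, mul_assoc]
        gcongr
        exact hi i
    _ = K * √t ^ 3 := by
        rw [← Finset.mul_sum, ← ht', pow_succ, Real.sq_sqrt ht0]; ring

end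

section

open Polynomial Matrix

/-! ### Second-order expansion of the entropy at `1/6 + P/3` -/

section Perturbation

variable {n : Type} [Fintype n] [DecidableEq n]

/-- The matrix with eigenvalue `1/2` on the range of the idempotent `P` and `1/6` on its kernel. -/
def twoLevel (P : Matrix n n ℂ) : Matrix n n ℂ := (1 / 6 : ℝ) • 1 + (1 / 3 : ℝ) • P

/-- The first-order part of `nodePoly` at `twoLevel P + D`. -/
def nodeLin (P D : Matrix n n ℂ) : Matrix n n ℂ := (1 / 3 : ℝ) • (P * D + D * P - D)

/-- The (negated) second-order term of the entropy at `twoLevel P`, in nats. -/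
def entropyForm (P D : Matrix n n ℂ) : ℝ :=
  3 * (D * D).trace.re + (3 * Real.log 3 - 6) * (P * (D * D)).trace.re
    + (4 - 3 * Real.log 3) * (P * D * (P * D)).trace.re

/-- The terms of order at least three of `entropyPoly` at `twoLevel P + D`. -/
def entropyRem (P D : Matrix n n ℂ) : Matrix n n ℂ :=
  (18 * Real.log 3 - 18) • (D * D * D)
    + (nodeLin P D * (D * D) + D * D * (nodeLin P D + D * D))
      * ((351 / 2 * Real.log 3 - 198) • 1 + (540 - 486 * Real.log 3) • (twoLevel P + D))
    + (540 - 486 * Real.log 3) • (nodeLin P D * nodeLin P D * D)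

/-- `nodePoly` annihilates `twoLevel P`, so there is no constant term; this is why the interpolation
error is cubic in `D`. -/
lemma aeval_nodePoly {P : Matrix n n ℂ} (hP : P * P = P) (D : Matrix n n ℂ) :
    aeval (twoLevel P + D) nodePoly = nodeLin P D + D * D := by
  simp only [nodePoly, map_add, map_sub, map_mul, aeval_X, aeval_C,
    Algebra.algebraMap_eq_smul_one, twoLevel, nodeLin, pow_two, mul_add, add_mul, smul_mul_assoc,
    mul_smul_comm, one_mul, mul_one, hP]
  module

lemma aeval_entropyPoly {P : Matrix n n ℂ} (hP : P * P = P) (D : Matrix n n ℂ) :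
    aeval (twoLevel P + D) entropyPoly =
      (Real.log 3 / 4) • 1 + (Real.log 2 - Real.log 3 / 2) • (twoLevel P + D)
      + (nodeLin P D + D * D) * ((6 - 15 / 2 * Real.log 3) • 1
          + (18 * Real.log 3 - 18) • twoLevel P)
      + (18 * Real.log 3 - 18) • (nodeLin P D * D)
      + nodeLin P D * nodeLin P D * ((351 / 2 * Real.log 3 - 198) • 1
          + (540 - 486 * Real.log 3) • twoLevel P)
      + entropyRem P D := by
  simp only [entropyPoly, map_add, map_mul, map_pow, aeval_X, aeval_C, aeval_nodePoly hP,
    Algebra.algebraMap_eq_smul_one, entropyRem]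
  generalize nodeLin P D = L
  generalize twoLevel P = R
  simp only [pow_two, mul_add, add_mul, smul_mul_assoc, mul_smul_comm, one_mul, mul_one,
    smul_add, mul_assoc]
  module

/-- Cyclicity of the trace and idempotence of `P` reduce every word of degree at most two in `D` to
the five traces that appear here and in `entropyForm`. The linear coefficients come from the
derivative of -x log x: log 6 - 1 at 1/6, and log 3 less at 1/2. -/
lemma trace_aeval_entropyPoly {P : Matrix n n ℂ} (hP : P * P = P) (D : Matrix n n ℂ) :
    (aeval (twoLevel P + D) entropyPoly).trace.re =
      (aeval (twoLevel P) entropyPoly).trace.re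
      + (Real.log 2 + Real.log 3 - 1) * D.trace.re - Real.log 3 * (P * D).trace.re
      - entropyForm P D + (entropyRem P D).trace.re := by
  have c1 : (D * P).trace = (P * D).trace := trace_mul_comm _ _
  have c2 : (P * (D * P)).trace = (P * D).trace := by
    rw [← mul_assoc, trace_mul_comm, ← mul_assoc, hP]
  have c3 : (D * (P * D)).trace = (P * (D * D)).trace := by
    rw [trace_mul_comm, mul_assoc]
  have c4 : (D * (D * P)).trace = (P * (D * D)).trace := by
    rw [← mul_assoc, trace_mul_comm]
  have c5 : (P * (D * (D * P))).trace = (P * (D * D)).trace := by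
    rw [← mul_assoc, ← mul_assoc, trace_mul_comm, ← mul_assoc, ← mul_assoc, hP, mul_assoc]
  have c6 : (D * (P * (D * P))).trace = (P * (D * (P * D))).trace := by
    rw [trace_mul_comm, mul_assoc, mul_assoc]
  have c7 : (P * (D * (P * (D * P)))).trace = (P * (D * (P * D))).trace := by
    rw [← mul_assoc, ← mul_assoc, ← mul_assoc, trace_mul_comm, ← mul_assoc, ← mul_assoc,
      ← mul_assoc, hP, mul_assoc, mul_assoc]
  have hP' : ∀ Z : Matrix n n ℂ, P * (P * Z) = P * Z := fun Z => by rw [← mul_assoc, hP]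
  have h0 : aeval (twoLevel P) entropyPoly =
      (Real.log 3 / 4) • 1 + (Real.log 2 - Real.log 3 / 2) • twoLevel P := by
    simpa [nodeLin, entropyRem] using aeval_entropyPoly hP 0
  rw [aeval_entropyPoly hP, h0, entropyForm]
  generalize entropyRem P D = R
  simp only [twoLevel, nodeLin, mul_add, add_mul, mul_sub, sub_mul, smul_mul_assoc, mul_smul_comm,
    one_mul, mul_one, smul_add, smul_sub, mul_assoc, hP, hP', trace_add, trace_sub, trace_smul,
    c1, c2, c3, c4, c5, c6, c7, Complex.add_re, Complex.sub_re, Complex.real_smul,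
    Complex.re_ofReal_mul]
  ring

end Perturbation

/-! ### The remainders -/

section Asymptotics

open Asymptotics
open scoped Matrix.Norms.Frobenius

variable {E F : Type*} [NormedAddCommGroup E] [NormedAddCommGroup F]

/-- `f v = O(‖v‖ ^ k)` as `v → 0`. -/
def IsOrder (k : ℕ) (f : E → F) : Prop := f =O[𝓝 0] fun v => ‖v‖ ^ k

variable {f g : E → F} {k l : ℕ}

lemma IsOrder.add (hf : IsOrder k f) (hg : IsOrder k g) : IsOrder k fun v => f v + g v :=
  IsBigO.add hf hg

lemma IsOrder.sub (hf : IsOrder k f) (hg : IsOrder k g) : IsOrder k fun v => f v - g v :=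
  IsBigO.sub hf hg

lemma IsOrder.smul [NormedSpace ℝ F] (hf : IsOrder k f) (c : ℝ) : IsOrder k fun v => c • f v :=
  IsBigO.const_smul_left hf c

lemma isOrder_const (c : F) : IsOrder 0 fun _ : E => c := by
  simpa [IsOrder] using isBigO_const_const c (one_ne_zero : (1 : ℝ) ≠ 0) (𝓝 (0 : E))

lemma isOrder_id : IsOrder 1 fun v : E => v := by
  simpa [IsOrder] using (isBigO_refl (fun v : E => v) (𝓝 0)).norm_right

lemma IsOrder.mul {R : Type*} [NormedRing R] {f g : E → R} (hf : IsOrder k f)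
    (hg : IsOrder l g) : IsOrder (k + l) fun v => f v * g v := by
  simpa [IsOrder, pow_add] using IsBigO.mul hf hg

lemma isBigO_norm_pow (h : l ≤ k) :
    (fun v : E => ‖v‖ ^ k) =O[𝓝 0] fun v => ‖v‖ ^ l := by
  refine IsBigO.of_bound 1 ?_
  filter_upwards [Metric.ball_mem_nhds (0 : E) one_pos] with v hv
  rw [one_mul, norm_pow, norm_pow, norm_norm]
  exact pow_le_pow_of_le_one (norm_nonneg v) (mem_ball_zero_iff.1 hv).le h

lemma IsOrder.mono (hf : IsOrder k f) (h : l ≤ k) : IsOrder l f :=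
  IsBigO.trans hf (isBigO_norm_pow h)

lemma IsOrder.isLittleO (hf : IsOrder 3 f) : f =o[𝓝 0] fun v => ‖v‖ ^ 2 := by
  refine IsBigO.trans_isLittleO hf ?_
  have h : (fun v : E => ‖v‖) =o[𝓝 0] fun _ : E => (1 : ℝ) := by
    rw [isLittleO_one_iff]; exact tendsto_norm_zero
  simpa only [pow_succ _ 2, mul_one] using
    (isBigO_refl (fun v : E => ‖v‖ ^ 2) (𝓝 0)).mul_isLittleO h

lemma IsOrder.trace_re {n : Type} [Fintype n] [DecidableEq n] {f : E → Matrix n n ℂ}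
    (hf : IsOrder k f) : IsOrder k fun v => (f v).trace.re :=
  ((Complex.reCLM.comp ((LinearMap.toContinuousLinearMap
    (traceLinearMap n ℂ ℂ)).restrictScalars ℝ)).isBigO_comp f (𝓝 0)).trans hf

end Asymptotics

/-! ### Entropy of Gram matrices near one with two eigenvalue levels -/

section Cut

open Asymptotics
open scoped Matrix.Norms.Frobenius

variable {n : Type} [Fintype n] [DecidableEq n]

lemma isOrder_nodeLin {E : Type*} [NormedAddCommGroup E] (P : Matrix n n ℂ) {k : ℕ}
    {D : E → Matrix n n ℂ} (hD : IsOrder k D) : IsOrder k fun v => nodeLin P (D v) := by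
  have h1 := (isOrder_const (E := E) P).mul hD
  have h2 := hD.mul (isOrder_const (E := E) P)
  rw [zero_add] at h1
  exact ((h1.add h2).sub hD).smul _

lemma isOrder_entropyRem {E : Type*} [NormedAddCommGroup E] (P : Matrix n n ℂ)
    {D : E → Matrix n n ℂ} (hD : IsOrder 1 D) : IsOrder 3 fun v => entropyRem P (D v) := by
  have hL := isOrder_nodeLin P hD
  have hD0 := hD.mono zero_le_one
  have hDD := hD.mul hD
  refine ((hDD.mul hD).smul _).add ?_ |>.add (((hL.mul hL).mul hD).smul _)
  exact ((hL.mul hDD).add (hDD.mul (hL.add (hDD.mono one_le_two)))).mul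
    (((isOrder_const (1 : Matrix n n ℂ)).smul _).add (((isOrder_const _).add hD0).smul _))

/-- The change of `N * Nᴴ` under a perturbation of `N`. -/
def gramDiff (N V : Matrix n n ℂ) : Matrix n n ℂ := N * Vᴴ + V * Nᴴ + V * Vᴴ

/-- The first-order part of the change of `N * Nᴴ`. -/
def gramLin (N V : Matrix n n ℂ) : Matrix n n ℂ := N * Vᴴ + V * Nᴴ

lemma isOrder_conjTranspose {m : Type} [Fintype m] :
    IsOrder 1 fun V : Matrix m m ℂ => Vᴴ := by
  refine IsBigO.of_norm_left ?_
  simp only [frobenius_norm_conjTranspose, pow_one]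
  exact isBigO_refl _ _

lemma isOrder_gramLin (N : Matrix n n ℂ) : IsOrder 1 (gramLin N) := by
  have h1 := (isOrder_const (E := Matrix n n ℂ) N).mul isOrder_conjTranspose
  have h2 := (isOrder_id (E := Matrix n n ℂ)).mul (isOrder_const (E := Matrix n n ℂ) Nᴴ)
  exact h1.add h2

lemma isOrder_mul_conjTranspose : IsOrder 2 fun V : Matrix n n ℂ => V * Vᴴ :=
  (isOrder_id (E := Matrix n n ℂ)).mul isOrder_conjTranspose

lemma isOrder_gramDiff (N : Matrix n n ℂ) : IsOrder 1 (gramDiff N) :=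
  (isOrder_gramLin N).add (isOrder_mul_conjTranspose.mono one_le_two)

/-- With D = X + W the quadratic words telescope as DD - XX = DW + WX, and W = `V * Vᴴ` already has
order two. -/
lemma isOrder_entropyForm_sub (P N : Matrix n n ℂ) :
    IsOrder 3 fun V => entropyForm P (gramDiff N V) - entropyForm P (gramLin N V) := by
  have hX := isOrder_gramLin N
  have hD := isOrder_gramDiff N
  have hW := isOrder_mul_conjTranspose (n := n)
  have hP := isOrder_const (E := Matrix n n ℂ) P
  have hs : ∀ V, gramDiff N V = gramLin N V + V * Vᴴ := fun V => rfl
  have h1 : IsOrder 3 fun V : Matrix n n ℂ =>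
      gramDiff N V * (V * Vᴴ) + V * Vᴴ * gramLin N V := (hD.mul hW).add (hW.mul hX)
  have h2 : IsOrder 3 fun V : Matrix n n ℂ =>
      P * (gramDiff N V * (V * Vᴴ) + V * Vᴴ * gramLin N V) := by simpa using hP.mul h1
  have h3 : IsOrder 3 fun V : Matrix n n ℂ =>
      P * gramDiff N V * (P * (V * Vᴴ)) + P * (V * Vᴴ) * (P * gramLin N V) := by
    have := ((hP.mul hD).mul (hP.mul hW)).add ((hP.mul hW).mul (hP.mul hX))
    simpa using this
  have h := ((h1.trace_re.smul 3).add (h2.trace_re.smul (3 * Real.log 3 - 6))).add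
    (h3.trace_re.smul (4 - 3 * Real.log 3))
  refine h.congr_left fun V => ?_
  simp only [entropyForm, hs]
  generalize gramLin N V = X
  generalize V * Vᴴ = W
  simp only [mul_add, add_mul, trace_add, Complex.add_re, smul_eq_mul, mul_assoc]
  ring

/-- The second-order expansion of the entropy of `V * Vᴴ` at `N`, when `N * Nᴴ` has the
eigenvalues `1/2` and `1/6`. -/
lemma entropy_gram_expansion {P N : Matrix n n ℂ} (hP : P * P = P) (hN : N * Nᴴ = twoLevel P) :
    (fun V => vonNeumannEntropy ((N + V) * (N + V)ᴴ) * Real.log 2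
      - ((aeval (twoLevel P) entropyPoly).trace.re
        + (Real.log 2 + Real.log 3 - 1) * (gramDiff N V).trace.re
        - Real.log 3 * (P * gramDiff N V).trace.re - entropyForm P (gramLin N V)))
      =o[𝓝 0] fun V => ‖V‖ ^ 2 := by
  have hD := isOrder_gramDiff N
  have hρ : ∀ V, (N + V) * (N + V)ᴴ = twoLevel P + gramDiff N V := fun V => by
    rw [conjTranspose_add, ← hN, gramDiff]; noncomm_ring
  obtain ⟨K, hK, hent⟩ := exists_abs_entropy_sub_trace_le (n := n)
  have hτ : IsOrder 2 fun V => (aeval ((N + V) * (N + V)ᴴ) (nodePoly ^ 2)).trace.re := by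
    simp only [hρ, map_pow, aeval_nodePoly hP, pow_two (_ + _)]
    have h1 := (isOrder_nodeLin P hD).add ((hD.mul hD).mono one_le_two)
    exact (h1.mul h1).trace_re
  have hτ0 : Filter.Tendsto (fun V => (aeval ((N + V) * (N + V)ᴴ) (nodePoly ^ 2)).trace.re)
      (𝓝 0) (𝓝 0) := by
    refine IsBigO.trans_tendsto hτ ?_
    have : Filter.Tendsto (fun V : Matrix n n ℂ => ‖V‖ ^ 2) (𝓝 0) (𝓝 (0 ^ 2)) :=
      tendsto_norm_zero.pow 2
    simpa using this
  -- The interpolation error is the cube of the square root of a second-order quantity.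
  have he : IsOrder 3 fun V => vonNeumannEntropy ((N + V) * (N + V)ᴴ) * Real.log 2
      - (aeval ((N + V) * (N + V)ᴴ) entropyPoly).trace.re := by
    obtain ⟨C, hC, hb⟩ := hτ.exists_pos
    refine IsBigO.of_bound (K * √C ^ 3) ?_
    filter_upwards [hb.bound, hτ0.eventually (Iic_mem_nhds (by norm_num : (0 : ℝ) < (1 / 48) ^ 2))]
      with V h1 h2
    refine (hent _ (isHermitian_mul_conjTranspose_self _) h2).trans ?_
    rw [norm_pow, norm_norm, mul_assoc, ← mul_pow]
    gcongr
    rw [norm_pow, norm_norm] at h1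
    calc _ ≤ √(C * ‖V‖ ^ 2) := Real.sqrt_le_sqrt ((Real.le_norm_self _).trans h1)
      _ = √C * ‖V‖ := by rw [Real.sqrt_mul hC.le, Real.sqrt_sq (norm_nonneg V)]
  have h := ((he.add (isOrder_entropyRem P hD).trace_re).sub
    (isOrder_entropyForm_sub P N)).isLittleO
  refine h.congr_left fun V => ?_
  rw [hρ, trace_aeval_entropyPoly hP]
  ring

end Cut

end

section

open Matrix

/-! ### The three balanced bipartitions -/

/-- The basis label with the entries of `x` on the pair of qubits `{0, c + 1}` and those of `y` on
the other two qubits. -/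
def label : Fin 3 → Fin 2 × Fin 2 → Fin 2 × Fin 2 → Fin 4 → Fin 2
  | 0, x, y => ![x.1, x.2, y.1, y.2]
  | 1, x, y => ![x.1, y.1, x.2, y.2]
  | 2, x, y => ![x.1, y.1, y.2, x.2]

/-- The matrix of amplitudes of a state with respect to a bipartition into two pairs of qubits. -/
def cut (c : Fin 3) : State →ₗ[ℂ] Matrix (Fin 2 × Fin 2) (Fin 2 × Fin 2) ℂ where
  toFun ψ := Matrix.of fun x y => ψ (label c x y)
  map_add' _ _ := rfl
  map_smul' _ _ := rfl

lemma cut_apply (c : Fin 3) (ψ : State) (x y : Fin 2 × Fin 2) :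
    cut c ψ x y = ψ (label c x y) := rfl

lemma vonNeumannEntropy_reducedDensity {S : Finset (Fin 4)}
    {r : Fin 2 × Fin 2 → {q // q ∈ S} → Fin 2} {s : Fin 2 × Fin 2 → {q // q ∉ S} → Fin 2}
    (hr : Function.Bijective r) (hs : Function.Bijective s) {ψ : State}
    {V : Matrix (Fin 2 × Fin 2) (Fin 2 × Fin 2) ℂ}
    (hV : ∀ x y, V x y = ψ (glue S (r x) (s y))) :
    vonNeumannEntropy (reducedDensity S ψ) = vonNeumannEntropy (V * Vᴴ) := by
  have hH : (reducedDensity S ψ).IsHermitian := by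
    ext a b
    simp [reducedDensity, conjTranspose_apply, mul_comm]
  rw [← vonNeumannEntropy_reindex (Equiv.ofBijective r hr) hH]
  congr 1
  ext x y
  simp only [submatrix_apply, reducedDensity, Equiv.ofBijective_apply, mul_apply,
    conjTranspose_apply, hV]
  exact ((Equiv.ofBijective s hs).sum_comp fun c =>
    ψ (glue S (r x) c) * starRingEnd ℂ (ψ (glue S (r y) c))).symm

/-- Schmidt symmetry: `V * Vᴴ` and `Vᴴ * V` have the same characteristic polynomial, so
complementary pairs have equal entropy. -/
lemma vonNeumannEntropy_transpose_mul (V : Matrix (Fin 2 × Fin 2) (Fin 2 × Fin 2) ℂ) :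
    vonNeumannEntropy (Vᵀ * Vᵀᴴ) = vonNeumannEntropy (V * Vᴴ) := by
  refine vonNeumannEntropy_congr (isHermitian_mul_conjTranspose_self _)
    (isHermitian_mul_conjTranspose_self _) ?_
  have h : Vᵀ * Vᵀᴴ = (Vᴴ * V)ᵀ := by
    rw [transpose_mul]; rfl
  rw [h, charpoly_transpose, charpoly_mul_comm]

/-- The pair of qubits containing qubit `0` in each bipartition. -/
def pairOf : Fin 3 → Finset (Fin 4)
  | 0 => {0, 1}
  | 1 => {0, 2}
  | 2 => {0, 3}

lemma entropy_pairOf (c : Fin 3) (ψ : State) :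
    vonNeumannEntropy (reducedDensity (pairOf c) ψ)
      = vonNeumannEntropy (cut c ψ * (cut c ψ)ᴴ) := by
  -- The argument 0 is a filler: on the pair the label depends only on `x`, off it only on `y`.
  refine vonNeumannEntropy_reducedDensity (r := fun x q => label c x 0 q)
    (s := fun y q => label c 0 y q) ?_ ?_ fun x y => ?_
  · revert c; decide
  · revert c; decide
  · have h : ∀ c x y, label c x y =
        glue (pairOf c) (fun q => label c x 0 q) (fun q => label c 0 y q) := by decide
    exact congrArg ψ (h c x y)

lemma entropy_compl_pairOf (c : Fin 3) (ψ : State) :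
    vonNeumannEntropy (reducedDensity (pairOf c)ᶜ ψ)
      = vonNeumannEntropy (cut c ψ * (cut c ψ)ᴴ) := by
  rw [← vonNeumannEntropy_transpose_mul]
  refine vonNeumannEntropy_reducedDensity (r := fun y q => label c 0 y q)
    (s := fun x q => label c x 0 q) ?_ ?_ fun y x => ?_
  · revert c; decide
  · revert c; decide
  · have h : ∀ c x y, label c x y =
        glue (pairOf c)ᶜ (fun q => label c 0 y q) (fun q => label c x 0 q) := by decide
    exact congrArg ψ (h c x y)

lemma E2_eq_sum_cut (ψ : State) :
    E2 ψ = (1 / 3 : ℝ) * ∑ c, vonNeumannEntropy (cut c ψ * (cut c ψ)ᴴ) := by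
  have h : (Finset.univ : Finset (Fin 4)).powersetCard 2
      = {pairOf 0, pairOf 1, pairOf 2, (pairOf 0)ᶜ, (pairOf 1)ᶜ, (pairOf 2)ᶜ} := by decide
  rw [E2, h, Finset.sum_insert (by decide), Finset.sum_insert (by decide),
    Finset.sum_insert (by decide), Finset.sum_insert (by decide), Finset.sum_insert (by decide),
    Finset.sum_singleton]
  simp only [entropy_pairOf, entropy_compl_pairOf, Fin.sum_univ_three]
  ring

/-! ### The amplitudes of `M₄` -/

lemma omega_eq : omega = ⟨-1 / 2, √3 / 2⟩ := by
  have h : (2 * Real.pi * Complex.I / 3 : ℂ) = ((Real.pi - Real.pi / 3 : ℝ) : ℂ) * Complex.I := by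
    push_cast; ring
  rw [omega, h, Complex.exp_mul_I]
  apply Complex.ext
  · rw [← Complex.ofReal_cos, ← Complex.ofReal_sin, Real.cos_pi_sub, Real.cos_pi_div_three]
    simp; norm_num
  · rw [← Complex.ofReal_cos, ← Complex.ofReal_sin, Real.cos_pi_sub, Real.sin_pi_sub,
      Real.sin_pi_div_three]
    simp

/-- The amplitudes of `√6 |M₄⟩`. -/
def coeff : Fin 2 → Fin 2 → Fin 2 → Fin 2 → ℂ
  | 0, 0, 1, 1 => 1
  | 1, 1, 0, 0 => 1
  | 0, 1, 0, 1 => ⟨-1 / 2, √3 / 2⟩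
  | 1, 0, 1, 0 => ⟨-1 / 2, √3 / 2⟩
  | 0, 1, 1, 0 => ⟨-1 / 2, -(√3 / 2)⟩
  | 1, 0, 0, 1 => ⟨-1 / 2, -(√3 / 2)⟩
  | _, _, _, _ => 0

lemma M4_apply (i j k l : Fin 2) :
    M4 ![i, j, k, l] = ((1 / √6 : ℝ) : ℂ) * coeff i j k l := by
  have hc : starRingEnd ℂ omega = ⟨-1 / 2, -(√3 / 2)⟩ := by rw [omega_eq]; rfl
  rw [M4, hc, omega_eq]
  simp only [PiLp.smul_apply, PiLp.add_apply, ket, PiLp.single_apply, smul_eq_mul]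
  congr 1
  fin_cases i <;> fin_cases j <;> fin_cases k <;> fin_cases l <;> simp [coeff]

/-- The projector onto the singlet state of two qubits. -/
def singlet : Matrix (Fin 2 × Fin 2) (Fin 2 × Fin 2) ℂ :=
  Matrix.of fun x y => (if x = y then 1 / 2 else 0) - (if x = y.swap then 1 / 2 else 0)

lemma singlet_mul_self : singlet * singlet = singlet := by
  ext ⟨a, b⟩ ⟨c, d⟩
  simp only [mul_apply, singlet, of_apply, Fintype.sum_prod_type, Fin.sum_univ_two]
  fin_cases a <;> fin_cases b <;> fin_cases c <;> fin_cases d <;> simp <;> norm_num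

/-- The matrix of amplitudes of `√6 |M₄⟩` with respect to a bipartition. -/
def coeffCut (c : Fin 3) : Matrix (Fin 2 × Fin 2) (Fin 2 × Fin 2) ℂ :=
  Matrix.of fun x y => coeff (label c x y 0) (label c x y 1) (label c x y 2) (label c x y 3)

lemma cut_M4 (c : Fin 3) : cut c M4 = (1 / √6 : ℝ) • coeffCut c := by
  ext x y
  have h : label c x y = ![label c x y 0, label c x y 1, label c x y 2, label c x y 3] := by
    funext i; fin_cases i <;> rfl
  rw [cut_apply, h, M4_apply, Matrix.smul_apply, Complex.real_smul]
  rfl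

set_option maxHeartbeats 1000000 in
-- `M4` has total spin zero, so each two-qubit marginal is rotation invariant: one weight on the
-- singlet, one on the triplet. The weights agree for the three cuts because qubit permutations
-- change `M4` only by a phase or complex conjugation.
lemma coeffCut_mul (c : Fin 3) :
    coeffCut c * (coeffCut c)ᴴ = (1 : ℝ) • 1 + (2 : ℝ) • singlet := by
  have h3 : √3 * √3 = 3 := Real.mul_self_sqrt (by norm_num)
  ext ⟨a, b⟩ ⟨a', b'⟩
  simp only [mul_apply, conjTranspose_apply, Fintype.sum_prod_type, Fin.sum_univ_two]
  fin_cases c <;> fin_cases a <;> fin_cases b <;> fin_cases a' <;> fin_cases b' <;>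
    simp [coeffCut, label, coeff, singlet, Complex.ext_iff] 
  all_goals constructor <;> linarith

lemma cut_M4_mul (c : Fin 3) : cut c M4 * (cut c M4)ᴴ = twoLevel singlet := by
  have h6 : 1 / √6 * (1 / √6) = 1 / 6 := by
    rw [div_mul_div_comm, Real.mul_self_sqrt (by norm_num)]; norm_num
  rw [cut_M4, conjTranspose_smul, star_trivial, smul_mul_assoc, mul_smul_comm, smul_smul, h6,
    coeffCut_mul, twoLevel, smul_add, smul_smul, smul_smul]
  norm_num

lemma bijective_label (c : Fin 3) :
    Function.Bijective fun p : (Fin 2 × Fin 2) × (Fin 2 × Fin 2) => label c p.1 p.2 := by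
  have h : ∀ b : Fin 4 → Fin 2, ∃ p : (Fin 2 × Fin 2) × (Fin 2 × Fin 2), label c p.1 p.2 = b := by
    revert c; decide
  exact (Fintype.bijective_iff_surjective_and_card _).2 ⟨h, rfl⟩

lemma sum_label {G : Type*} [AddCommMonoid G] (c : Fin 3) (f : (Fin 4 → Fin 2) → G) :
    ∑ x, ∑ y, f (label c x y) = ∑ b, f b := by
  rw [← Fintype.sum_prod_type' fun x y => f (label c x y)]
  exact (Equiv.ofBijective _ (bijective_label c)).sum_comp f

lemma trace_cut_mul (c : Fin 3) (ψ : State) :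
    (cut c ψ * (cut c ψ)ᴴ).trace = ((‖ψ‖ ^ 2 : ℝ) : ℂ) := by
  rw [EuclideanSpace.norm_sq_eq, ← sum_label c, trace]
  push_cast
  refine Finset.sum_congr rfl fun x _ => ?_
  rw [diag_apply, mul_apply]
  refine Finset.sum_congr rfl fun y _ => ?_
  rw [conjTranspose_apply, cut_apply, Complex.star_def, Complex.mul_conj, Complex.normSq_eq_norm_sq,
    Complex.ofReal_pow]

lemma norm_M4 : ‖M4‖ = 1 := by
  have h := trace_cut_mul 0 M4
  rw [cut_M4_mul] at h
  have h1 : (twoLevel singlet).trace = 1 := by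
    simp [twoLevel, singlet, trace, Fintype.sum_prod_type, Fin.sum_univ_two]
    norm_num
  rw [h1] at h
  have h2 : ‖M4‖ ^ 2 = 1 := by exact_mod_cast h.symm
  nlinarith [norm_nonneg M4]

end

section

open Matrix

/-! ### The Hessian of the average entropy at `M₄` -/

lemma entropyForm_smul {n : Type} [Fintype n] [DecidableEq n] (P X : Matrix n n ℂ) (r : ℝ) :
    entropyForm P (r • X) = r ^ 2 * entropyForm P X := by
  simp only [entropyForm, smul_mul_assoc, mul_smul_comm, trace_smul, Complex.real_smul,
    Complex.re_ofReal_mul]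
  ring

lemma trace_singlet_mul (X : Matrix (Fin 2 × Fin 2) (Fin 2 × Fin 2) ℂ) :
    (singlet * X).trace =
      (X (0, 1) (0, 1) + X (1, 0) (1, 0) - X (0, 1) (1, 0) - X (1, 0) (0, 1)) / 2 := by
  simp [trace, mul_apply, singlet, Fintype.sum_prod_type, Fin.sum_univ_two]
  ring

/-- This uses that `singlet` has rank one. -/
lemma trace_singlet_mul_singlet_mul (X : Matrix (Fin 2 × Fin 2) (Fin 2 × Fin 2) ℂ) :
    (singlet * X * (singlet * X)).trace = (singlet * X).trace ^ 2 := by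
  rw [trace_singlet_mul]
  simp [trace, mul_apply, singlet, Fintype.sum_prod_type, Fin.sum_univ_two]
  ring

/-- The entropy form for the singlet projector, at a Hermitian matrix given by its entries. -/
lemma entropyForm_singlet {X : Matrix (Fin 2 × Fin 2) (Fin 2 × Fin 2) ℂ} (hX : X.IsHermitian) :
    entropyForm singlet X =
      3 * (Complex.normSq (X (0, 0) (0, 0)) + Complex.normSq (X (1, 1) (1, 1))
        + Complex.normSq (X (0, 1) (0, 1)) + Complex.normSq (X (1, 0) (1, 0))
        + 2 * (Complex.normSq (X (0, 0) (0, 1)) + Complex.normSq (X (0, 0) (1, 0))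
          + Complex.normSq (X (0, 0) (1, 1)) + Complex.normSq (X (0, 1) (1, 0))
          + Complex.normSq (X (1, 1) (0, 1)) + Complex.normSq (X (1, 1) (1, 0))))
      + (3 * Real.log 3 - 6) / 2 * (Complex.normSq (X (0, 0) (0, 1) - X (0, 0) (1, 0))
        + Complex.normSq (X (1, 1) (0, 1) - X (1, 1) (1, 0))
        + ((X (0, 1) (0, 1)).re - (X (0, 1) (1, 0)).re) ^ 2
        + ((X (1, 0) (1, 0)).re - (X (0, 1) (1, 0)).re) ^ 2
        + 2 * (X (0, 1) (1, 0)).im ^ 2)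
      + (4 - 3 * Real.log 3) / 4 * ((X (0, 1) (0, 1)).re + (X (1, 0) (1, 0)).re
        - 2 * (X (0, 1) (1, 0)).re) ^ 2 := by
  have h : ∀ x y, X y x = starRingEnd ℂ (X x y) := fun x y => (hX.apply y x).symm
  have hd : ∀ x, (X x x).im = 0 := fun x => Complex.conj_eq_iff_im.1 (h x x).symm
  rw [entropyForm, trace_singlet_mul_singlet_mul, trace_singlet_mul, trace_singlet_mul]
  simp only [trace, diag_apply, mul_apply, Fintype.sum_prod_type, Fin.sum_univ_two,
    h (0, 0) (0, 1), h (0, 0) (1, 0), h (0, 0) (1, 1), h (0, 1) (1, 0), h (1, 1) (0, 1),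
    h (1, 1) (1, 0), Complex.normSq_apply, Complex.add_re, Complex.mul_re, Complex.sub_re,
    Complex.conj_re, Complex.conj_im, Complex.div_ofNat_re, Complex.div_ofNat_im, Complex.sub_im,
    Complex.add_im, hd, pow_two]
  ring

/-- The overlap `⟨M₄|v⟩`, up to the factor `1 / √6`. -/
def overlap (v : State) : ℂ :=
  v ![0, 0, 1, 1] + v ![1, 1, 0, 0] + starRingEnd ℂ omega * (v ![0, 1, 0, 1] + v ![1, 0, 1, 0])
    + omega * (v ![0, 1, 1, 0] + v ![1, 0, 0, 1])

/-- The overlap with the complex conjugate of `M₄`, up to the factor `1 / √6`. -/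
def conjOverlap (v : State) : ℂ :=
  v ![0, 0, 1, 1] + v ![1, 1, 0, 0] + omega * (v ![0, 1, 0, 1] + v ![1, 0, 1, 0])
    + starRingEnd ℂ omega * (v ![0, 1, 1, 0] + v ![1, 0, 0, 1])

/-- The squared norm of the component of total spin two. -/
def spinTwoNormSq (v : State) : ℝ :=
  Complex.normSq (v ![0, 0, 0, 0]) + Complex.normSq (v ![1, 1, 1, 1])
    + Complex.normSq (v ![1, 0, 0, 0] + v ![0, 1, 0, 0] + v ![0, 0, 1, 0] + v ![0, 0, 0, 1]) / 4
    + Complex.normSq (v ![0, 1, 1, 1] + v ![1, 0, 1, 1] + v ![1, 1, 0, 1] + v ![1, 1, 1, 0]) / 4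
    + Complex.normSq (v ![0, 0, 1, 1] + v ![1, 1, 0, 0] + v ![0, 1, 0, 1] + v ![1, 0, 1, 0]
      + v ![0, 1, 1, 0] + v ![1, 0, 0, 1]) / 6

/-- The components of total spin one and magnetic number zero, one for each bipartition. -/
def spinOneZero : Fin 3 → State → ℂ
  | 0, v => v ![0, 0, 1, 1] - v ![1, 1, 0, 0]
  | 1, v => starRingEnd ℂ omega * (v ![0, 1, 0, 1] - v ![1, 0, 1, 0])
  | 2, v => omega * (v ![0, 1, 1, 0] - v ![1, 0, 0, 1])

/-- The components of total spin one and magnetic number one. -/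
def spinOneUp : Fin 3 → State → ℂ
  | 0, v => v ![1, 0, 0, 0] + v ![0, 1, 0, 0] - v ![0, 0, 1, 0] - v ![0, 0, 0, 1]
  | 1, v => starRingEnd ℂ omega *
      (v ![1, 0, 0, 0] - v ![0, 1, 0, 0] + v ![0, 0, 1, 0] - v ![0, 0, 0, 1])
  | 2, v => omega * (v ![1, 0, 0, 0] - v ![0, 1, 0, 0] - v ![0, 0, 1, 0] + v ![0, 0, 0, 1])

/-- The components of total spin one and magnetic number minus one. -/
def spinOneDown : Fin 3 → State → ℂ
  | 0, v => v ![0, 1, 1, 1] + v ![1, 0, 1, 1] - v ![1, 1, 0, 1] - v ![1, 1, 1, 0]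
  | 1, v => starRingEnd ℂ omega *
      (v ![0, 1, 1, 1] - v ![1, 0, 1, 1] + v ![1, 1, 0, 1] - v ![1, 1, 1, 0])
  | 2, v => omega * (v ![0, 1, 1, 1] - v ![1, 0, 1, 1] - v ![1, 1, 0, 1] + v ![1, 1, 1, 0])

/-- The squared norm of the part of the spin-one component normal to the local unitary orbit. -/
def spinOneNormSq (v : State) : ℝ :=
  ∑ c, ((spinOneZero c v).re ^ 2 / 2
    + Complex.normSq (spinOneUp c v + starRingEnd ℂ (spinOneDown c v)) / 8)

/-- The second-order term of the entropy, summed over the three bipartitions, in nats. -/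
def hessian (v : State) : ℝ :=
  -((overlap v).re ^ 2 + Complex.normSq (conjOverlap v) / 2
    + (3 - 3 / 2 * Real.log 3) * spinTwoNormSq v + (2 + 3 * Real.log 3) * spinOneNormSq v)

lemma norm_sq_eq_sum_amplitudes (v : State) :
    ‖v‖ ^ 2 = ∑ i, ∑ j, ∑ k, ∑ l, Complex.normSq (v ![i, j, k, l]) := by
  rw [EuclideanSpace.norm_sq_eq, ← sum_label 0]
  simp only [Fintype.sum_prod_type, label, Complex.normSq_eq_norm_sq]

lemma gramLin_isHermitian {n : Type} [Fintype n] [DecidableEq n] (N V : Matrix n n ℂ) :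
    (gramLin N V).IsHermitian := by
  rw [IsHermitian, gramLin, conjTranspose_add, conjTranspose_mul, conjTranspose_mul,
    conjTranspose_conjTranspose, conjTranspose_conjTranspose, add_comm]

lemma trace_singlet_gram_re (V : Matrix (Fin 2 × Fin 2) (Fin 2 × Fin 2) ℂ) :
    (singlet * (V * Vᴴ)).trace.re =
      ∑ i, ∑ j, Complex.normSq (V (0, 1) (i, j) - V (1, 0) (i, j)) / 2 := by
  rw [trace_singlet_mul]
  simp [mul_apply, Fintype.sum_prod_type, Fin.sum_univ_two, Complex.normSq_apply]
  ring

set_option maxHeartbeats 4000000 in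
set_option maxRecDepth 100000 in
-- Rotation invariance of `M4` forces the form to respect total spin, and the powers of ω in the
-- spin-one components align phases so that the three cuts decouple. The factor 1/6 undoes the
-- scaling of `coeffCut`; the term 3/2 ‖v‖² is what remains of the first-order part once the change
-- of norm is split off. With real and imaginary parts as variables this is a polynomial identity
-- modulo √3² = 3, with log 3 an indeterminate.
lemma hessian_eq (v : State) :
    Real.log 3 * (3 / 2 * ‖v‖ ^ 2 - ∑ c, (singlet * (cut c v * (cut c v)ᴴ)).trace.re)
      - (1 / 6) * ∑ c, entropyForm singlet (gramLin (coeffCut c) (cut c v)) = hessian v := by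
  have h3 : √3 ^ 2 = 3 := Real.sq_sqrt (by norm_num)
  simp only [entropyForm_singlet (gramLin_isHermitian _ _), norm_sq_eq_sum_amplitudes,
    trace_singlet_gram_re, hessian, spinOneNormSq, spinTwoNormSq, spinOneZero, spinOneUp,
    spinOneDown, overlap, conjOverlap, omega_eq]
  simp only [gramLin, Matrix.add_apply, mul_apply, conjTranspose_apply, Fintype.sum_prod_type,
    Fin.sum_univ_two, Fin.sum_univ_three, cut_apply, coeffCut, of_apply, label, coeff,
    Matrix.cons_val]
  simp only [Complex.normSq_apply, Complex.add_re, Complex.add_im, Complex.mul_re, Complex.mul_im,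
    Complex.sub_re, Complex.sub_im, Complex.star_def, Complex.conj_re, Complex.conj_im,
    map_zero, map_one, mul_zero, zero_mul, mul_one, one_mul, add_zero, zero_add]
  generalize √3 = s at *
  generalize Real.log 3 = B
  generalize v ![0, 0, 0, 0] = a0
  generalize v ![0, 0, 0, 1] = a1
  generalize v ![0, 0, 1, 0] = a2
  generalize v ![0, 0, 1, 1] = a3
  generalize v ![0, 1, 0, 0] = a4
  generalize v ![0, 1, 0, 1] = a5
  generalize v ![0, 1, 1, 0] = a6
  generalize v ![0, 1, 1, 1] = a7
  generalize v ![1, 0, 0, 0] = a8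
  generalize v ![1, 0, 0, 1] = a9
  generalize v ![1, 0, 1, 0] = a10
  generalize v ![1, 0, 1, 1] = a11
  generalize v ![1, 1, 0, 0] = a12
  generalize v ![1, 1, 0, 1] = a13
  generalize v ![1, 1, 1, 0] = a14
  generalize v ![1, 1, 1, 1] = a15
  ring_nf
  simp only [h3]
  ring

end

section

open Matrix Asymptotics Polynomial
open scoped Matrix.Norms.Frobenius

/-! ### The expansion of `E₂` at `M₄` -/

/-- This is the criticality of `M4`. It fails for a single cut; in the sum the contributions of the
conjugate state cancel, their phases being the cube roots of unity. -/
lemma sum_trace_singlet_gramLin (v : State) :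
    ∑ c, (singlet * gramLin (coeffCut c) (cut c v)).trace.re =
      1 / 2 * ∑ c, (gramLin (coeffCut c) (cut c v)).trace.re := by
  simp only [trace_singlet_mul]
  simp only [trace, diag_apply, gramLin, Matrix.add_apply, mul_apply, conjTranspose_apply,
    Fintype.sum_prod_type, Fin.sum_univ_two, Fin.sum_univ_three, cut_apply, coeffCut, of_apply,
    label, coeff, Matrix.cons_val]
  simp only [Complex.div_ofNat_re, Complex.add_re, Complex.sub_re, Complex.mul_re, Complex.star_def,
    Complex.conj_re, Complex.conj_im, map_zero, map_one, mul_zero, zero_mul, mul_one, one_mul,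
    add_zero, zero_add]
  ring

lemma gramLin_smul {n : Type} [Fintype n] [DecidableEq n] (r : ℝ) (N V : Matrix n n ℂ) :
    gramLin (r • N) V = r • gramLin N V := by
  simp [gramLin, conjTranspose_smul]

lemma mul_conjTranspose_add {n : Type} [Fintype n] [DecidableEq n] (N V : Matrix n n ℂ) :
    (N + V) * (N + V)ᴴ = N * Nᴴ + (gramLin N V + V * Vᴴ) := by
  rw [conjTranspose_add, gramLin]; noncomm_ring

lemma trace_gramLin_cut (c : Fin 3) (v : State) :
    (gramLin (cut c M4) (cut c v)).trace.re = ‖M4 + v‖ ^ 2 - 1 - ‖v‖ ^ 2 := by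
  have h := trace_cut_mul c (M4 + v)
  rw [map_add, mul_conjTranspose_add, trace_add, trace_add, trace_cut_mul, trace_cut_mul,
    norm_M4] at h
  have h' := congrArg Complex.re h
  simp only [Complex.add_re, Complex.ofReal_re] at h'
  linarith

lemma cut_isBigO (c : Fin 3) : (fun v => cut c v) =O[𝓝 0] fun v : State => v :=
  ((LinearMap.toContinuousLinearMap (cut c))).isBigO_id _

lemma cut_tendsto (c : Fin 3) : Filter.Tendsto (fun v => cut c v) (𝓝 0) (𝓝 0) := by
  simpa using ((LinearMap.toContinuousLinearMap (cut c)).continuous.tendsto 0)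

lemma cut_entropy_expansion (c : Fin 3) :
    (fun v : State => (vonNeumannEntropy (cut c (M4 + v) * (cut c (M4 + v))ᴴ)
        - vonNeumannEntropy (cut c M4 * (cut c M4)ᴴ)) * Real.log 2
      - ((Real.log 2 + Real.log 3 - 1) * (‖M4 + v‖ ^ 2 - 1)
        - Real.log 3 * ((singlet * gramLin (cut c M4) (cut c v)).trace.re
          + (singlet * (cut c v * (cut c v)ᴴ)).trace.re)
        - entropyForm singlet (gramLin (cut c M4) (cut c v))))
      =o[𝓝 0] fun v => ‖v‖ ^ 2 := by
  have h := entropy_gram_expansion singlet_mul_self (cut_M4_mul c)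
  have h0 : vonNeumannEntropy (cut c M4 * (cut c M4)ᴴ) * Real.log 2 =
      (aeval (twoLevel singlet) entropyPoly).trace.re := by
    -- A bound by ‖V‖² forces equality at V = 0, which identifies the constant term.
    have h1 := (h.def one_pos).self_of_nhds
    simp [gramDiff, gramLin, entropyForm, sub_eq_zero] at h1
    exact h1
  have h2 := (h.comp_tendsto (cut_tendsto c)).trans_isBigO ((cut_isBigO c).norm_norm.pow 2)
  refine h2.congr_left fun v => ?_
  simp only [Function.comp_apply]
  have h3 : gramDiff (cut c M4) (cut c v) = gramLin (cut c M4) (cut c v)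
    + cut c v * (cut c v)ᴴ := rfl
  rw [h3, mul_add, trace_add, trace_add, Complex.add_re, Complex.add_re, trace_gramLin_cut,
    trace_cut_mul, Complex.ofReal_re, ← h0, map_add]
  ring

/-- The second-order expansion of `E₂` at `M₄`. The term that is linear in the change of the
squared norm vanishes on the unit sphere. -/
theorem E2_expansion : ∃ κ : ℝ,
    (fun v : State => E2 (M4 + v) - E2 M4 - κ * (‖M4 + v‖ ^ 2 - 1)
      - hessian v / (3 * Real.log 2)) =o[𝓝 0] fun v => ‖v‖ ^ 2 := by
  have hl2 : Real.log 2 ≠ 0 := (Real.log_pos (by norm_num)).ne'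
  -- The trace coefficient log 2 + log 3 - 1, less half of log 3 contributed by the singlet traces.
  refine ⟨(Real.log 2 + Real.log 3 / 2 - 1) / Real.log 2, ?_⟩
  have h := (IsLittleO.fun_sum (s := Finset.univ)
    fun c _ => cut_entropy_expansion c).const_mul_left (1 / (3 * Real.log 2))
  refine h.congr_left fun v => ?_
  have h6 : (1 / √6 : ℝ) ^ 2 = 1 / 6 := by
    rw [div_pow, Real.sq_sqrt (by norm_num)]; norm_num
  have hs : ∑ c, (singlet * gramLin (cut c M4) (cut c v)).trace.re =
      1 / 2 * ∑ c, (gramLin (cut c M4) (cut c v)).trace.re := by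
    have := congrArg (fun x => 1 / √6 * x) (sum_trace_singlet_gramLin v)
    simp only [cut_M4, gramLin_smul, mul_smul_comm, trace_smul, Complex.real_smul,
      Complex.re_ofReal_mul, ← Finset.mul_sum]
    linarith
  have hH := hessian_eq v
  simp only [trace_gramLin_cut, Finset.sum_const, Finset.card_univ, Fintype.card_fin,
    nsmul_eq_mul] at hs
  have hF : ∑ c, entropyForm singlet (gramLin (cut c M4) (cut c v)) =
      1 / 6 * ∑ c, entropyForm singlet (gramLin (coeffCut c) (cut c v)) := by
    simp only [cut_M4, gramLin_smul, entropyForm_smul, h6, Finset.mul_sum]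
  rw [← hF] at hH
  rw [E2_eq_sum_cut, E2_eq_sum_cut, ← hH]
  simp only [Finset.sum_sub_distrib, ← Finset.sum_mul, ← Finset.mul_sum, Finset.sum_add_distrib,
    Finset.sum_const, Finset.card_univ, Fintype.card_fin, nsmul_eq_mul, hs]
  push_cast
  field_simp
  ring

end

section

open Matrix

/-! ### The null directions of the Hessian -/

/-- The Hermitian `2 × 2` matrix with Pauli coordinates `t, x, y, z`. -/
def herm (t x y z : ℝ) : Matrix (Fin 2) (Fin 2) ℂ :=
  !![⟨t + z, 0⟩, ⟨x, -y⟩; ⟨x, y⟩, ⟨t - z, 0⟩]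

lemma herm_isHermitian (t x y z : ℝ) : (herm t x y z).IsHermitian := by
  ext i j
  fin_cases i <;> fin_cases j <;> simp [herm, Complex.ext_iff]

lemma applyQubit_zero_apply (H : Matrix (Fin 2) (Fin 2) ℂ) (ψ : State) (i j k l : Fin 2) :
    applyQubit 0 H ψ ![i, j, k, l] = H i 0 * ψ ![0, j, k, l] + H i 1 * ψ ![1, j, k, l] := by
  have h : ∀ s, Function.update ![i, j, k, l] 0 s = ![s, j, k, l] := fun s => by
    funext q; fin_cases q <;> rfl
  simp [applyQubit, h]

lemma applyQubit_one_apply (H : Matrix (Fin 2) (Fin 2) ℂ) (ψ : State) (i j k l : Fin 2) :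
    applyQubit 1 H ψ ![i, j, k, l] = H j 0 * ψ ![i, 0, k, l] + H j 1 * ψ ![i, 1, k, l] := by
  have h : ∀ s, Function.update ![i, j, k, l] 1 s = ![i, s, k, l] := fun s => by
    funext q; fin_cases q <;> rfl
  simp [applyQubit, h]

lemma applyQubit_two_apply (H : Matrix (Fin 2) (Fin 2) ℂ) (ψ : State) (i j k l : Fin 2) :
    applyQubit 2 H ψ ![i, j, k, l] = H k 0 * ψ ![i, j, 0, l] + H k 1 * ψ ![i, j, 1, l] := by
  have h : ∀ s, Function.update ![i, j, k, l] 2 s = ![i, j, s, l] := fun s => by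
    funext q; fin_cases q <;> rfl
  simp [applyQubit, h]

lemma applyQubit_three_apply (H : Matrix (Fin 2) (Fin 2) ℂ) (ψ : State) (i j k l : Fin 2) :
    applyQubit 3 H ψ ![i, j, k, l] = H l 0 * ψ ![i, j, k, 0] + H l 1 * ψ ![i, j, k, 1] := by
  have h : ∀ s, Function.update ![i, j, k, l] 3 s = ![i, j, k, s] := fun s => by
    funext q; fin_cases q <;> rfl
  simp [applyQubit, h]

lemma state_ext {ψ φ : State} (h : ∀ i j k l, ψ ![i, j, k, l] = φ ![i, j, k, l]) : ψ = φ := by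
  ext b
  have hb : b = ![b 0, b 1, b 2, b 3] := by funext i; fin_cases i <;> rfl
  rw [hb]; exact h _ _ _ _

/-- The states of total spin at most one, from their components. -/
lemma amplitudes_eq {v : State} (h2 : spinTwoNormSq v = 0) (hc : conjOverlap v = 0) :
    (v ![0, 0, 0, 0] = 0 ∧ v ![1, 1, 1, 1] = 0) ∧
    (v ![1, 0, 0, 0] = (spinOneUp 0 v + omega * spinOneUp 1 v
        + starRingEnd ℂ omega * spinOneUp 2 v) / 4 ∧
      v ![0, 1, 0, 0] = (spinOneUp 0 v - omega * spinOneUp 1 v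
        - starRingEnd ℂ omega * spinOneUp 2 v) / 4 ∧
      v ![0, 0, 1, 0] = (-spinOneUp 0 v + omega * spinOneUp 1 v
        - starRingEnd ℂ omega * spinOneUp 2 v) / 4 ∧
      v ![0, 0, 0, 1] = (-spinOneUp 0 v - omega * spinOneUp 1 v
        + starRingEnd ℂ omega * spinOneUp 2 v) / 4) ∧
    (v ![0, 1, 1, 1] = (spinOneDown 0 v + omega * spinOneDown 1 v
        + starRingEnd ℂ omega * spinOneDown 2 v) / 4 ∧
      v ![1, 0, 1, 1] = (spinOneDown 0 v - omega * spinOneDown 1 v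
        - starRingEnd ℂ omega * spinOneDown 2 v) / 4 ∧
      v ![1, 1, 0, 1] = (-spinOneDown 0 v + omega * spinOneDown 1 v
        - starRingEnd ℂ omega * spinOneDown 2 v) / 4 ∧
      v ![1, 1, 1, 0] = (-spinOneDown 0 v - omega * spinOneDown 1 v
        + starRingEnd ℂ omega * spinOneDown 2 v) / 4) ∧
    (v ![0, 0, 1, 1] = (overlap v / 3 + spinOneZero 0 v) / 2 ∧
      v ![1, 1, 0, 0] = (overlap v / 3 - spinOneZero 0 v) / 2 ∧
      v ![0, 1, 0, 1] = omega * (overlap v / 3 + spinOneZero 1 v) / 2 ∧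
      v ![1, 0, 1, 0] = omega * (overlap v / 3 - spinOneZero 1 v) / 2 ∧
      v ![0, 1, 1, 0] = starRingEnd ℂ omega * (overlap v / 3 + spinOneZero 2 v) / 2 ∧
      v ![1, 0, 0, 1] = starRingEnd ℂ omega * (overlap v / 3 - spinOneZero 2 v) / 2) := by
  have hm : omega * starRingEnd ℂ omega = 1 := by
    rw [Complex.mul_conj, omega_eq, Complex.normSq_mk]
    have : √3 * √3 = 3 := Real.mul_self_sqrt (by norm_num)
    rw [show (-1 / 2 * (-1 / 2) + √3 / 2 * (√3 / 2) : ℝ) = 1 by linarith, Complex.ofReal_one]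
  have hp : omega + starRingEnd ℂ omega = -1 := by
    rw [omega_eq]; apply Complex.ext <;> norm_num
  have key : ∀ a b c d e : ℂ, Complex.normSq a + Complex.normSq b + Complex.normSq c / 4
      + Complex.normSq d / 4 + Complex.normSq e / 6 = 0 →
      a = 0 ∧ b = 0 ∧ c = 0 ∧ d = 0 ∧ e = 0 := fun a b c d e h => by
    have := Complex.normSq_nonneg a
    have := Complex.normSq_nonneg b
    have := Complex.normSq_nonneg c
    have := Complex.normSq_nonneg d
    have := Complex.normSq_nonneg e
    simp only [← Complex.normSq_eq_zero]
    refine ⟨?_, ?_, ?_, ?_, ?_⟩ <;> linarith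
  obtain ⟨h0, h4, h1, h3, h2⟩ := key _ _ _ _ _ h2
  simp only [conjOverlap, overlap, spinOneUp, spinOneDown, spinOneZero] at hc ⊢
  generalize starRingEnd ℂ omega = w' at *
  generalize omega = w at *
  refine ⟨⟨h0, h4⟩, ⟨?_, ?_, ?_, ?_⟩, ⟨?_, ?_, ?_, ?_⟩, ?_, ?_, ?_, ?_, ?_, ?_⟩
  · linear_combination h1 / 4 - hm / 4 * (v ![1, 0, 0, 0] - v ![0, 1, 0, 0] + v ![0, 0, 1, 0] - v ![0, 0, 0, 1])
      - hm / 4 * (v ![1, 0, 0, 0] - v ![0, 1, 0, 0] - v ![0, 0, 1, 0] + v ![0, 0, 0, 1])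
  · linear_combination h1 / 4 + hm / 4 * (v ![1, 0, 0, 0] - v ![0, 1, 0, 0] + v ![0, 0, 1, 0] - v ![0, 0, 0, 1])
      + hm / 4 * (v ![1, 0, 0, 0] - v ![0, 1, 0, 0] - v ![0, 0, 1, 0] + v ![0, 0, 0, 1])
  · linear_combination h1 / 4 - hm / 4 * (v ![1, 0, 0, 0] - v ![0, 1, 0, 0] + v ![0, 0, 1, 0] - v ![0, 0, 0, 1])
      + hm / 4 * (v ![1, 0, 0, 0] - v ![0, 1, 0, 0] - v ![0, 0, 1, 0] + v ![0, 0, 0, 1])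
  · linear_combination h1 / 4 + hm / 4 * (v ![1, 0, 0, 0] - v ![0, 1, 0, 0] + v ![0, 0, 1, 0] - v ![0, 0, 0, 1])
      - hm / 4 * (v ![1, 0, 0, 0] - v ![0, 1, 0, 0] - v ![0, 0, 1, 0] + v ![0, 0, 0, 1])
  · linear_combination h3 / 4 - hm / 4 * (v ![0, 1, 1, 1] - v ![1, 0, 1, 1] + v ![1, 1, 0, 1] - v ![1, 1, 1, 0])
      - hm / 4 * (v ![0, 1, 1, 1] - v ![1, 0, 1, 1] - v ![1, 1, 0, 1] + v ![1, 1, 1, 0])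
  · linear_combination h3 / 4 + hm / 4 * (v ![0, 1, 1, 1] - v ![1, 0, 1, 1] + v ![1, 1, 0, 1] - v ![1, 1, 1, 0])
      + hm / 4 * (v ![0, 1, 1, 1] - v ![1, 0, 1, 1] - v ![1, 1, 0, 1] + v ![1, 1, 1, 0])
  · linear_combination h3 / 4 - hm / 4 * (v ![0, 1, 1, 1] - v ![1, 0, 1, 1] + v ![1, 1, 0, 1] - v ![1, 1, 1, 0])
      + hm / 4 * (v ![0, 1, 1, 1] - v ![1, 0, 1, 1] - v ![1, 1, 0, 1] + v ![1, 1, 1, 0])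
  · linear_combination h3 / 4 + hm / 4 * (v ![0, 1, 1, 1] - v ![1, 0, 1, 1] + v ![1, 1, 0, 1] - v ![1, 1, 1, 0])
      - hm / 4 * (v ![0, 1, 1, 1] - v ![1, 0, 1, 1] - v ![1, 1, 0, 1] + v ![1, 1, 1, 0])
  · linear_combination hc / 6 + h2 / 6 - hp / 6 * (v ![0, 1, 0, 1] + v ![1, 0, 1, 0]
      + v ![0, 1, 1, 0] + v ![1, 0, 0, 1])
  · linear_combination hc / 6 + h2 / 6 - hp / 6 * (v ![0, 1, 0, 1] + v ![1, 0, 1, 0]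
      + v ![0, 1, 1, 0] + v ![1, 0, 0, 1])
  · linear_combination w' / 6 * hc + h2 / 6 - hp / 6 * (v ![0, 0, 1, 1] + v ![1, 1, 0, 0])
      - hm / 3 * (v ![0, 1, 0, 1] + v ![1, 0, 1, 0])
      - (hp / 6 * (w + w' - 1) - hm / 3) * (v ![0, 1, 1, 0] + v ![1, 0, 0, 1])
      - hm / 2 * (v ![0, 1, 0, 1] - v ![1, 0, 1, 0])
  · linear_combination w' / 6 * hc + h2 / 6 - hp / 6 * (v ![0, 0, 1, 1] + v ![1, 1, 0, 0])
      - hm / 3 * (v ![0, 1, 0, 1] + v ![1, 0, 1, 0])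
      - (hp / 6 * (w + w' - 1) - hm / 3) * (v ![0, 1, 1, 0] + v ![1, 0, 0, 1])
      + hm / 2 * (v ![0, 1, 0, 1] - v ![1, 0, 1, 0])
  · linear_combination w / 6 * hc + h2 / 6 - hp / 6 * (v ![0, 0, 1, 1] + v ![1, 1, 0, 0])
      - hm / 3 * (v ![0, 1, 1, 0] + v ![1, 0, 0, 1])
      - (hp / 6 * (w + w' - 1) - hm / 3) * (v ![0, 1, 0, 1] + v ![1, 0, 1, 0])
      - hm / 2 * (v ![0, 1, 1, 0] - v ![1, 0, 0, 1])
  · linear_combination w / 6 * hc + h2 / 6 - hp / 6 * (v ![0, 0, 1, 1] + v ![1, 1, 0, 0])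
      - hm / 3 * (v ![0, 1, 1, 0] + v ![1, 0, 0, 1])
      - (hp / 6 * (w + w' - 1) - hm / 3) * (v ![0, 1, 0, 1] + v ![1, 0, 1, 0])
      + hm / 2 * (v ![0, 1, 1, 0] - v ![1, 0, 0, 1])

/-- The states of total spin at most one that satisfy the remaining conditions of tangency are
infinitesimal local unitary transformations of `M₄`. -/
lemma exists_herm_of_components {v : State} (h2 : spinTwoNormSq v = 0) (hc : conjOverlap v = 0)
    (ho : (overlap v).re = 0) (hz : ∀ c, (spinOneZero c v).re = 0)
    (hu : ∀ c, spinOneUp c v + starRingEnd ℂ (spinOneDown c v) = 0) :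
    ∃ t x y z : Fin 4 → ℝ,
      v = Complex.I • ∑ k, applyQubit k (herm (t k) (x k) (y k) (z k)) M4 := by
  obtain ⟨⟨e0, e15⟩, ⟨e8, e4, e2, e1⟩, ⟨e7, e11, e13, e14⟩, e3, e12, e5, e10, e6, e9⟩ :=
    amplitudes_eq h2 hc
  have ho' : overlap v = ⟨0, (overlap v).im⟩ := Complex.ext ho rfl
  have hz' : ∀ c, spinOneZero c v = ⟨0, (spinOneZero c v).im⟩ := fun c => Complex.ext (hz c) rfl
  have hd : ∀ c, spinOneDown c v = ⟨-(spinOneUp c v).re, (spinOneUp c v).im⟩ := fun c => by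
    have h := hu c
    apply Complex.ext
    · have := congrArg Complex.re h
      simp only [Complex.add_re, Complex.conj_re, Complex.zero_re] at this
      linarith
    · have := congrArg Complex.im h
      simp only [Complex.add_im, Complex.conj_im, Complex.zero_im] at this
      linarith
  have hup : ∀ c, spinOneUp c v = ⟨(spinOneUp c v).re, (spinOneUp c v).im⟩ := fun c => rfl
  rw [ho', hz'] at e3 e12
  rw [ho', hz', omega_eq] at e5 e10 e6 e9
  rw [hup 0, hup 1, hup 2, omega_eq] at e8 e4 e2 e1
  rw [hd 0, hd 1, hd 2, omega_eq] at e7 e11 e13 e14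
  generalize (overlap v).im = o at *
  generalize (spinOneZero 0 v).im = d0 at *
  generalize (spinOneZero 1 v).im = d1 at *
  generalize (spinOneZero 2 v).im = d2 at *
  generalize (spinOneUp 0 v).re = p0 at *
  generalize (spinOneUp 1 v).re = p1 at *
  generalize (spinOneUp 2 v).re = p2 at *
  generalize (spinOneUp 0 v).im = q0 at *
  generalize (spinOneUp 1 v).im = q1 at *
  generalize (spinOneUp 2 v).im = q2 at *
  -- The sign patterns of the three bipartitions invert the spin-one components. The four entries
  -- sum to zero: a common rotation of all qubits fixes `M4`, so that freedom is normalised away.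
  let f (a b c : ℝ) : Fin 4 → ℝ := ![√6 / 8 * (a + b + c), √6 / 8 * (a - b - c),
    √6 / 8 * (-a + b - c), √6 / 8 * (-a - b + c)]
  refine ⟨fun _ => √6 / 24 * o, f q0 q1 q2, f p0 p1 p2, f d0 d1 d2, state_ext fun i j k l => ?_⟩
  have h6 : √6 ^ 2 = 6 := Real.sq_sqrt (by norm_num)
  rw [PiLp.smul_apply, Fin.sum_univ_four]
  simp only [PiLp.add_apply, applyQubit_zero_apply, applyQubit_one_apply, applyQubit_two_apply,
    applyQubit_three_apply, M4_apply]
  fin_cases i <;> fin_cases j <;> fin_cases k <;> fin_cases l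
  all_goals
    simp only [Fin.zero_eta, Fin.mk_one, e0, e1, e2, e3, e4, e5, e6, e7, e8, e9, e10, e11, e12,
      e13, e14, e15, coeff, herm, f]
    simp [Complex.ext_iff]
  all_goals try constructor
  all_goals
    ring_nf
    try simp only [h6]
    try ring

/-- The upper bound makes the spin-two coefficient 3 - (3/2) log 3 positive. -/
lemma log_three_bounds : 0 < Real.log 3 ∧ Real.log 3 < 2 := by
  refine ⟨Real.log_pos (by norm_num), ?_⟩
  rw [Real.log_lt_iff_lt_exp (by norm_num)]
  have := Real.add_one_lt_exp (two_ne_zero' ℝ)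
  linarith

lemma spinTwoNormSq_nonneg (v : State) : 0 ≤ spinTwoNormSq v := by
  unfold spinTwoNormSq
  have n := Complex.normSq_nonneg
  refine add_nonneg (add_nonneg (add_nonneg (add_nonneg (n _) (n _)) ?_) ?_) ?_ <;>
    exact div_nonneg (n _) (by norm_num)

lemma spinOneNormSq_nonneg (v : State) : 0 ≤ spinOneNormSq v :=
  Finset.sum_nonneg fun _ _ => add_nonneg (div_nonneg (sq_nonneg _) (by norm_num))
    (div_nonneg (Complex.normSq_nonneg _) (by norm_num))

lemma hessian_nonpos (v : State) : hessian v ≤ 0 := by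
  obtain ⟨h0, h2⟩ := log_three_bounds
  have h3 := mul_nonneg (by linarith : 0 ≤ 3 - 3 / 2 * Real.log 3) (spinTwoNormSq_nonneg v)
  have h4 := mul_nonneg (by linarith : 0 ≤ 2 + 3 * Real.log 3) (spinOneNormSq_nonneg v)
  have h5 := Complex.normSq_nonneg (conjOverlap v)
  unfold hessian
  linarith [sq_nonneg (overlap v).re]

lemma exists_herm_of_hessian_eq_zero {v : State} (h : hessian v = 0) :
    ∃ t x y z : Fin 4 → ℝ,
      v = Complex.I • ∑ k, applyQubit k (herm (t k) (x k) (y k) (z k)) M4 := by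
  obtain ⟨h0, h2⟩ := log_three_bounds
  have c2 : 0 < 3 - 3 / 2 * Real.log 3 := by linarith
  have c1 : 0 < 2 + 3 * Real.log 3 := by linarith
  have h3 := mul_nonneg c2.le (spinTwoNormSq_nonneg v)
  have h4 := mul_nonneg c1.le (spinOneNormSq_nonneg v)
  have h5 := Complex.normSq_nonneg (conjOverlap v)
  have h6 := sq_nonneg (overlap v).re
  unfold hessian at h
  have e2 : (3 - 3 / 2 * Real.log 3) * spinTwoNormSq v = 0 := by linarith
  have e1 : (2 + 3 * Real.log 3) * spinOneNormSq v = 0 := by linarith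
  have e1' := (mul_eq_zero.1 e1).resolve_left c1.ne'
  have hs : ∀ c, (spinOneZero c v).re ^ 2 / 2
      + Complex.normSq (spinOneUp c v + starRingEnd ℂ (spinOneDown c v)) / 8 = 0 := fun c =>
    (Finset.sum_eq_zero_iff_of_nonneg fun _ _ => add_nonneg (div_nonneg (sq_nonneg _) (by norm_num))
      (div_nonneg (Complex.normSq_nonneg _) (by norm_num))).1 e1' c (Finset.mem_univ c)
  have hs' := fun c => Complex.normSq_nonneg (spinOneUp c v + starRingEnd ℂ (spinOneDown c v))
  refine exists_herm_of_components ((mul_eq_zero.1 e2).resolve_left c2.ne') ?_ ?_ ?_ ?_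
  · exact Complex.normSq_eq_zero.1 (by linarith)
  · exact pow_eq_zero_iff two_ne_zero |>.1 (by linarith)
  · exact fun c => pow_eq_zero_iff two_ne_zero |>.1
      (by linarith [hs c, hs' c, sq_nonneg (spinOneZero c v).re])
  · exact fun c => Complex.normSq_eq_zero.1
      (by linarith [hs c, hs' c, sq_nonneg (spinOneZero c v).re])

lemma isInfinitesimalLocalUnitary_of_hessian_eq_zero {v : State} (h : hessian v = 0) :
    IsInfinitesimalLocalUnitary M4 v := by
  obtain ⟨t, x, y, z, hv⟩ := exists_herm_of_hessian_eq_zero h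
  exact ⟨_, fun _ => herm_isHermitian _ _ _ _, hv⟩

end

section

open Matrix Asymptotics Filter

/-! ### Variations -/

lemma continuous_hessian : Continuous hessian := by
  have n := Complex.continuous_normSq
  have h : ∀ b : Fin 4 → Fin 2, Continuous fun v : State => v b := fun b => by fun_prop
  unfold hessian spinOneNormSq spinTwoNormSq
  simp only [Fin.sum_univ_three, spinOneZero, spinOneUp, spinOneDown, overlap, conjOverlap]
  fun_prop

lemma hessian_smul (t : ℝ) (v : State) : hessian (t • v) = t ^ 2 * hessian v := by
  have hc : ∀ c, cut c (t • v) = t • cut c v := fun c => rfl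
  have hg : ∀ c, gramLin (coeffCut c) (t • cut c v) = t • gramLin (coeffCut c) (cut c v) :=
    fun c => by simp [gramLin, conjTranspose_smul]
  rw [← hessian_eq, ← hessian_eq]
  simp only [hc, hg, entropyForm_smul, conjTranspose_smul, star_trivial, smul_mul_assoc,
    mul_smul_comm, trace_smul, Complex.real_smul, Complex.re_ofReal_mul, norm_smul, mul_pow,
    Real.norm_eq_abs, sq_abs, ← Finset.mul_sum]
  ring

/-- Write v(t) = t w(t) with w(t) → d; homogeneity gives G(v(t)) = t² G(w(t)), and continuity of `G`
at `d` suffices. -/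
lemma isLittleO_of_homogeneous {E : Type*} [NormedAddCommGroup E] [NormedSpace ℝ E] {G : E → ℝ}
    (hG : Continuous G) (hh : ∀ (t : ℝ) v, G (t • v) = t ^ 2 * G v) {v : ℝ → E} {d : E}
    (hv : (fun t => v t - t • d) =o[𝓝 0] fun t => t) :
    (fun t => G (v t) - t ^ 2 * G d) =o[𝓝 0] fun t => t ^ 2 := by
  have hw : Tendsto (fun t => t⁻¹ • (v t - t • d) + d) (𝓝 0) (𝓝 d) := by
    simpa using hv.tendsto_inv_smul_nhds_zero.add_const d
  have h0 : v 0 = 0 := by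
    have := (hv.def one_pos).self_of_nhds
    simpa using this
  have hvw : ∀ t, v t = t • (t⁻¹ • (v t - t • d) + d) := fun t => by
    rcases eq_or_ne t 0 with rfl | ht
    · simp [h0]
    · rw [smul_add, smul_inv_smul₀ ht, sub_add_cancel]
  have h1 : (fun t => G (t⁻¹ • (v t - t • d) + d) - G d) =o[𝓝 0] fun _ => (1 : ℝ) := by
    rw [isLittleO_one_iff]
    simpa using ((hG.tendsto d).comp hw).sub_const (G d)
  have h2 := (isBigO_refl (fun t : ℝ => t ^ 2) (𝓝 0)).mul_isLittleO h1
  refine (h2.congr_left fun t => ?_).congr_right fun t => mul_one _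
  conv_rhs => rw [hvw t, hh]
  ring

/-- The path need not stay on the sphere, but the two normalisation conditions make ‖γ(t)‖² - 1 =
o(t²), so the κ term of `E2_expansion` drops out. -/
lemma hasVariations_E2 {d d2 : State} (h1 : 2 * (inner ℂ d M4).re = 0)
    (h2 : 2 * (inner ℂ d2 M4).re + (inner ℂ d d).re = 0) :
    HasVariations E2 M4 d d2 0 (hessian d / (3 * Real.log 2)) := by
  intro γ hγ
  obtain ⟨κ, hκ⟩ := E2_expansion
  set v : ℝ → State := fun t => γ t - M4 with hv
  have hρ : (fun t => v t - (t • d + t ^ 2 • d2)) =o[𝓝 0] fun t : ℝ => t ^ 2 :=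
    hγ.congr_left fun t => by simp only [hv]; abel
  have hsq : (fun t : ℝ => t ^ 2) =o[𝓝 0] fun t => t := by
    simpa using isLittleO_pow_pow (𝕜 := ℝ) (m := 1) (n := 2) (by norm_num)
  have hlin : (fun t => v t - t • d) =o[𝓝 0] fun t : ℝ => t := by
    have h3 : (fun t : ℝ => t ^ 2 • d2) =o[𝓝 0] fun t : ℝ => t := by
      refine IsBigO.trans_isLittleO ?_ hsq
      exact IsBigO.of_bound ‖d2‖ (Eventually.of_forall fun t => by
        rw [norm_smul, mul_comm])
    refine ((hρ.trans hsq).add h3).congr_left fun t => by abel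
  have hvO : v =O[𝓝 0] fun t : ℝ => t := by
    have h3 : (fun t : ℝ => t • d) =O[𝓝 0] fun t : ℝ => t :=
      IsBigO.of_bound ‖d‖ (Eventually.of_forall fun t => by rw [norm_smul, mul_comm])
    exact (hlin.isBigO.add h3).congr_left fun t => by abel
  have hv0 : Tendsto v (𝓝 0) (𝓝 0) := hvO.trans_tendsto tendsto_id
  have e1 := (hκ.comp_tendsto hv0).trans_isBigO ((hvO.norm_left).pow 2)
  have e2 := isLittleO_of_homogeneous continuous_hessian hessian_smul hlin
  have e3 := isLittleO_of_homogeneous (G := fun v : State => ‖v‖ ^ 2) (by fun_prop)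
    (fun t v => by simp [norm_smul, mul_pow]) hlin
  have e4 : (fun t => (inner ℂ (v t - (t • d + t ^ 2 • d2)) M4).re) =o[𝓝 0]
      fun t : ℝ => t ^ 2 := by
    refine IsBigO.trans_isLittleO (IsBigO.of_bound ‖M4‖ (Eventually.of_forall fun t => ?_)) hρ
    rw [mul_comm]
    exact (Complex.abs_re_le_norm _).trans (norm_inner_le_norm _ _)
  have h := (e1.add ((e3.add (e4.const_mul_left 2)).const_mul_left κ)).add
    (e2.const_mul_left (1 / (3 * Real.log 2)))
  refine h.congr_left fun t => ?_
  have hM : M4 + v t = γ t := by simp [hv]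
  have hn : ‖M4 + v t‖ ^ 2 = 1 + 2 * (inner ℂ (v t) M4).re + ‖v t‖ ^ 2 := by
    rw [norm_add_sq (𝕜 := ℂ), norm_M4, inner_re_symm, one_pow]
    rfl
  have hi : (inner ℂ (v t - (t • d + t ^ 2 • d2)) M4).re =
      (inner ℂ (v t) M4).re - t * (inner ℂ d M4).re - t ^ 2 * (inner ℂ d2 M4).re := by
    rw [inner_sub_left, inner_add_left, ← Complex.coe_smul, ← Complex.coe_smul, inner_smul_left,
      inner_smul_left, Complex.conj_ofReal, Complex.conj_ofReal, Complex.sub_re, Complex.add_re,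
      Complex.re_ofReal_mul, Complex.re_ofReal_mul]
    ring
  have hd : (inner ℂ d d).re = ‖d‖ ^ 2 := by
    simpa using inner_self_eq_norm_sq (𝕜 := ℂ) d
  simp only [Function.comp_apply]
  rw [hi, hn, hM]
  rw [hd] at h2
  linear_combination (-κ * t) * h1 - (κ * t ^ 2) * h2

/-! ### The normal slice to the local unitary orbit -/

/-- The vectors that are real-orthogonal to the local unitary orbit of `M₄`. -/
def normalSpace : Set State :=
  {v | ∀ k t x y z, (inner ℂ v (Complex.I • applyQubit k (herm t x y z) M4)).re = 0}

lemma isClosed_normalSpace : IsClosed normalSpace := by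
  simp only [normalSpace, Set.ofPred_forall]
  refine isClosed_iInter fun _ => isClosed_iInter fun _ => isClosed_iInter fun _ =>
    isClosed_iInter fun _ => isClosed_iInter fun _ => isClosed_eq ?_ continuous_const
  fun_prop

/-- A null vector is tangent to the orbit, hence orthogonal to itself when it is also normal. -/
lemma eq_zero_of_mem_normalSpace {v : State} (hv : v ∈ normalSpace) (h : hessian v = 0) :
    v = 0 := by
  obtain ⟨t, x, y, z, e⟩ := exists_herm_of_hessian_eq_zero h
  have h1 : (inner ℂ v v).re = 0 := by
    conv_lhs => enter [1, 3]; rw [e]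
    rw [Finset.smul_sum, inner_sum, Complex.re_sum]
    exact Finset.sum_eq_zero fun k _ => hv _ _ _ _ _
  have h2 : (inner ℂ v v).re = ‖v‖ ^ 2 := by simpa using inner_self_eq_norm_sq (𝕜 := ℂ) v
  rw [h2] at h1
  simpa using h1

lemma smul_mem_normalSpace {v : State} (hv : v ∈ normalSpace) (r : ℝ) : r • v ∈ normalSpace :=
  fun k t x y z => by
    rw [← Complex.coe_smul, inner_smul_left, Complex.conj_ofReal, Complex.re_ofReal_mul,
      hv k t x y z, mul_zero]

/-- Strict negativity becomes uniform by compactness of the unit sphere of the normal space, then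
extends by homogeneity. -/
lemma exists_hessian_le : ∃ c > 0, ∀ v ∈ normalSpace, hessian v ≤ -c * ‖v‖ ^ 2 := by
  have hK : IsCompact (normalSpace ∩ Metric.sphere (0 : State) 1) :=
    (isCompact_sphere _ _).inter_left isClosed_normalSpace
  obtain hne | hne := (normalSpace ∩ Metric.sphere (0 : State) 1).eq_empty_or_nonempty
  · refine ⟨1, one_pos, fun v hv => ?_⟩
    rcases eq_or_ne v 0 with rfl | h0
    · simpa using hessian_nonpos 0
    · have : ‖v‖⁻¹ • v ∈ normalSpace ∩ Metric.sphere (0 : State) 1 :=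
        ⟨smul_mem_normalSpace hv _, by simp [norm_smul, h0]⟩
      simp [hne] at this
  · obtain ⟨w, hw, hmax⟩ := hK.exists_isMaxOn hne continuous_hessian.continuousOn
    have hw0 : hessian w < 0 := lt_of_le_of_ne (hessian_nonpos w) fun h => by
      have := eq_zero_of_mem_normalSpace hw.1 h
      have h1 := hw.2
      simp [this] at h1
    refine ⟨-hessian w, by linarith, fun v hv => ?_⟩
    rcases eq_or_ne v 0 with rfl | h0
    · simpa using hessian_nonpos 0
    · have hm : ‖v‖⁻¹ • v ∈ normalSpace ∩ Metric.sphere (0 : State) 1 :=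
        ⟨smul_mem_normalSpace hv _, by simp [norm_smul, h0]⟩
      have h1 : hessian (‖v‖⁻¹ • v) ≤ hessian w := hmax hm
      have hp : 0 < ‖v‖ := norm_pos_iff.2 h0
      rw [hessian_smul, inv_pow, inv_mul_le_iff₀ (by positivity)] at h1
      linarith

/-- On the slice, `E₂` is locally maximal at `M₄`. -/
lemma exists_E2_le_of_mem_normalSpace :
    ∃ r > 0, ∀ v ∈ normalSpace, ‖v‖ < r → ‖M4 + v‖ = 1 → E2 (M4 + v) ≤ E2 M4 := by
  obtain ⟨c, hc, hle⟩ := exists_hessian_le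
  obtain ⟨κ, hκ⟩ := E2_expansion
  have hl : 0 < 3 * Real.log 2 := mul_pos (by norm_num) (Real.log_pos (by norm_num))
  -- The tolerance c / (3 log 2) is exactly what the negative quadratic term absorbs.
  obtain ⟨r, hr, hb⟩ := Metric.eventually_nhds_iff_ball.1 (hκ.def (div_pos hc hl))
  refine ⟨r, hr, fun v hv hvr h1 => ?_⟩
  have h2 := hb v (mem_ball_zero_iff.2 hvr)
  rw [h1, norm_pow, norm_norm, Real.norm_eq_abs] at h2
  have h3 := (le_abs_self _).trans h2
  have h4 := div_le_div_of_nonneg_right (hle v hv) hl.le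
  have h5 : -c * ‖v‖ ^ 2 / (3 * Real.log 2) = -(c / (3 * Real.log 2) * ‖v‖ ^ 2) := by ring
  rw [h5] at h4
  linarith

end

section

open Matrix Filter
open scoped Kronecker

/-! ### Invariance under local unitaries -/

lemma applyQubit_apply (k : Fin 4) (H : Matrix (Fin 2) (Fin 2) ℂ) (ψ : State)
    (b : Fin 4 → Fin 2) : applyQubit k H ψ b = ∑ s, H (b k) s * ψ (Function.update b k s) := rfl

lemma applyQubit_add_matrix (k : Fin 4) (H K : Matrix (Fin 2) (Fin 2) ℂ) (ψ : State) :
    applyQubit k (H + K) ψ = applyQubit k H ψ + applyQubit k K ψ := by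
  ext b
  simp only [applyQubit_apply, PiLp.add_apply, Matrix.add_apply, add_mul, Finset.sum_add_distrib]

lemma applyQubit_smul_matrix (k : Fin 4) (a : ℂ) (H : Matrix (Fin 2) (Fin 2) ℂ) (ψ : State) :
    applyQubit k (a • H) ψ = a • applyQubit k H ψ := by
  ext b
  simp only [applyQubit_apply, PiLp.smul_apply, Matrix.smul_apply, smul_eq_mul, mul_assoc,
    Finset.mul_sum]

lemma applyQubit_one_matrix (k : Fin 4) (ψ : State) : applyQubit k 1 ψ = ψ := by
  ext b
  simp [applyQubit_apply, Matrix.one_apply]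

lemma inner_applyQubit (k : Fin 4) {H : Matrix (Fin 2) (Fin 2) ℂ} (hH : H.IsHermitian)
    (ψ φ : State) : inner ℂ (applyQubit k H ψ) φ = inner ℂ ψ (applyQubit k H φ) := by
  have h : ∀ i j, starRingEnd ℂ (H i j) = H j i := fun i j => hH.apply j i
  simp only [PiLp.inner_apply, RCLike.inner_apply, ← sum_label 0, Fintype.sum_prod_type, label,
    Fin.sum_univ_two]
  fin_cases k <;>
    simp only [Fin.zero_eta, Fin.mk_one, Fin.reduceFinMk, applyQubit_zero_apply,
      applyQubit_one_apply, applyQubit_two_apply, applyQubit_three_apply, map_add, map_mul, h] <;>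
    ring

/-- A one-qubit unitary acts on the rows of the cut if its qubit lies in the pair containing qubit
0, and otherwise, transposed, on the columns. -/
lemma exists_unitary_cut {U : Matrix (Fin 2) (Fin 2) ℂ} (hU : Uᴴ * U = 1) (k : Fin 4)
    (c : Fin 3) (ψ : State) : ∃ L R : Matrix (Fin 2 × Fin 2) (Fin 2 × Fin 2) ℂ,
      Lᴴ * L = 1 ∧ R * Rᴴ = 1 ∧ cut c (applyQubit k U ψ) = L * cut c ψ * R := by
  have hU' : Uᵀ * Uᵀᴴ = 1 := by
    have h : Uᵀ * Uᵀᴴ = (Uᴴ * U)ᵀ := by rw [transpose_mul]; rfl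
    rw [h, hU, transpose_one]
  have l1 : (U ⊗ₖ (1 : Matrix (Fin 2) (Fin 2) ℂ))ᴴ * (U ⊗ₖ 1) = 1 := by
    rw [conjTranspose_kronecker, ← mul_kronecker_mul, hU, conjTranspose_one, one_mul,
      one_kronecker_one]
  have l2 : ((1 : Matrix (Fin 2) (Fin 2) ℂ) ⊗ₖ U)ᴴ * (1 ⊗ₖ U) = 1 := by
    rw [conjTranspose_kronecker, ← mul_kronecker_mul, hU, conjTranspose_one, one_mul,
      one_kronecker_one]
  have r1 : (Uᵀ ⊗ₖ (1 : Matrix (Fin 2) (Fin 2) ℂ)) * (Uᵀ ⊗ₖ 1)ᴴ = 1 := by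
    rw [conjTranspose_kronecker, ← mul_kronecker_mul, hU', conjTranspose_one, one_mul,
      one_kronecker_one]
  have r2 : ((1 : Matrix (Fin 2) (Fin 2) ℂ) ⊗ₖ Uᵀ) * (1 ⊗ₖ Uᵀ)ᴴ = 1 := by
    rw [conjTranspose_kronecker, ← mul_kronecker_mul, hU', conjTranspose_one, one_mul,
      one_kronecker_one]
  have i1 : (1 : Matrix (Fin 2 × Fin 2) (Fin 2 × Fin 2) ℂ)ᴴ * 1 = 1 := by simp
  have i2 : (1 : Matrix (Fin 2 × Fin 2) (Fin 2 × Fin 2) ℂ) * 1ᴴ = 1 := by simp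
  have key : cut c (applyQubit k U ψ) = (U ⊗ₖ 1) * cut c ψ ∨
      cut c (applyQubit k U ψ) = (1 ⊗ₖ U) * cut c ψ ∨
      cut c (applyQubit k U ψ) = cut c ψ * (Uᵀ ⊗ₖ 1) ∨
      cut c (applyQubit k U ψ) = cut c ψ * (1 ⊗ₖ Uᵀ) := by
    fin_cases c <;> fin_cases k
    on_goal 1 => left
    on_goal 2 => right; left
    on_goal 3 => right; right; left
    on_goal 4 => right; right; right
    on_goal 5 => left
    on_goal 6 => right; right; left
    on_goal 7 => right; left
    on_goal 8 => right; right; right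
    on_goal 9 => left
    on_goal 10 => right; right; left
    on_goal 11 => right; right; right
    on_goal 12 => right; left
    all_goals
      ext ⟨i, j⟩ ⟨k, l⟩
      simp [mul_apply, Fintype.sum_prod_type, Fin.sum_univ_two, cut_apply, label, one_apply,
        applyQubit_zero_apply, applyQubit_one_apply, applyQubit_two_apply, applyQubit_three_apply]
    all_goals ring
  rcases key with h | h | h | h
  · exact ⟨_, 1, l1, i2, by rw [h, mul_one]⟩
  · exact ⟨_, 1, l2, i2, by rw [h, mul_one]⟩
  · exact ⟨1, _, i1, r1, by rw [h, one_mul]⟩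
  · exact ⟨1, _, i1, r2, by rw [h, one_mul]⟩

lemma charpoly_cut_applyQubit {U : Matrix (Fin 2) (Fin 2) ℂ} (hU : Uᴴ * U = 1) (k : Fin 4)
    (c : Fin 3) (ψ : State) :
    (cut c (applyQubit k U ψ) * (cut c (applyQubit k U ψ))ᴴ).charpoly =
      (cut c ψ * (cut c ψ)ᴴ).charpoly := by
  obtain ⟨L, R, hL, hR, h⟩ := exists_unitary_cut hU k c ψ
  have e : cut c (applyQubit k U ψ) * (cut c (applyQubit k U ψ))ᴴ =
      L * (cut c ψ * (cut c ψ)ᴴ * Lᴴ) := by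
    rw [h, conjTranspose_mul, conjTranspose_mul]
    calc _ = L * cut c ψ * (R * Rᴴ) * ((cut c ψ)ᴴ * Lᴴ) := by noncomm_ring
      _ = _ := by rw [hR]; noncomm_ring
  rw [e, charpoly_mul_comm, mul_assoc, hL, mul_one]

/-- The states with the same spectra of reduced density matrices as `ψ`. -/
def isospectral (ψ : State) : Set State :=
  {φ | ∀ c : Fin 3, (cut c φ * (cut c φ)ᴴ).charpoly = (cut c ψ * (cut c ψ)ᴴ).charpoly}

lemma applyQubit_mem_isospectral {U : Matrix (Fin 2) (Fin 2) ℂ} (hU : Uᴴ * U = 1) (k : Fin 4)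
    {ψ φ : State} (h : φ ∈ isospectral ψ) : applyQubit k U φ ∈ isospectral ψ :=
  fun c => (charpoly_cut_applyQubit hU k c φ).trans (h c)

lemma E2_eq_of_mem_isospectral {ψ φ : State} (h : φ ∈ isospectral ψ) : E2 φ = E2 ψ := by
  rw [E2_eq_sum_cut, E2_eq_sum_cut]
  congr 1
  exact Finset.sum_congr rfl fun c _ =>
    vonNeumannEntropy_congr (isHermitian_mul_conjTranspose_self _)
      (isHermitian_mul_conjTranspose_self _) (h c)

lemma norm_eq_of_mem_isospectral {ψ φ : State} (h : φ ∈ isospectral ψ) : ‖φ‖ = ‖ψ‖ := by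
  have h1 := trace_cut_mul 0 φ
  rw [trace_eq_neg_charpoly_coeff, h 0, ← trace_eq_neg_charpoly_coeff, trace_cut_mul] at h1
  have h2 : ‖ψ‖ ^ 2 = ‖φ‖ ^ 2 := by exact_mod_cast h1
  exact ((sq_eq_sq₀ (norm_nonneg _) (norm_nonneg _)).1 h2).symm

/-- Equality of characteristic polynomials is tested by evaluating at every z, each evaluation being
a determinant continuous in the state. -/
lemma isClosed_isospectral (ψ : State) : IsClosed (isospectral ψ) := by
  have h : isospectral ψ = ⋂ c : Fin 3, ⋂ z : ℂ,
      {φ | (Matrix.scalar _ z - cut c φ * (cut c φ)ᴴ).det =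
        (Matrix.scalar _ z - cut c ψ * (cut c ψ)ᴴ).det} := by
    ext φ
    simp only [isospectral, Set.mem_iInter, Set.mem_ofPred_eq, ← eval_charpoly]
    exact forall_congr' fun c => ⟨fun h z => by rw [h], Polynomial.funext⟩
  rw [h]
  refine isClosed_iInter fun c => isClosed_iInter fun z => isClosed_eq ?_ continuous_const
  have hc : Continuous fun φ : State => cut c φ := by
    refine continuous_matrix fun x y => ?_
    simp only [cut_apply]
    fun_prop
  exact (continuous_const.sub (hc.matrix_mul hc.matrix_conjTranspose)).matrix_det

/-! ### Reduction to the slice -/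

/-- For a Hermitian involution this is the unitary exp(itσ), written without the matrix exponential.
-/
lemma conjTranspose_mul_rotation {σ : Matrix (Fin 2) (Fin 2) ℂ} (hσ : σ.IsHermitian)
    (h2 : σ * σ = 1) (t : ℝ) :
    ((Real.cos t : ℂ) • (1 : Matrix (Fin 2) (Fin 2) ℂ) + ((Real.sin t : ℂ) * Complex.I) • σ)ᴴ *
      ((Real.cos t : ℂ) • 1 + ((Real.sin t : ℂ) * Complex.I) • σ) = 1 := by
  have h1 : (Real.cos t : ℂ) * Real.cos t + (Real.sin t : ℂ) * Real.sin t = 1 := by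
    have := Real.cos_sq_add_sin_sq t
    rw [pow_two, pow_two] at this
    exact_mod_cast this
  rw [conjTranspose_add, conjTranspose_smul, conjTranspose_smul, conjTranspose_one, hσ]
  simp only [Complex.star_def, map_mul, Complex.conj_ofReal, Complex.conj_I, mul_add, add_mul,
    smul_mul_assoc, mul_smul_comm, one_mul, mul_one, h2]
  generalize (Real.cos t : ℂ) = c at *
  generalize (Real.sin t : ℂ) = s at *
  match_scalars
  · linear_combination h1 - s * s * Complex.I_mul_I
  · ring

/-- At a point nearest to `M₄` in an isospectral class, the displacement from `M₄` is normal to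
the directions of one-qubit rotations about a Hermitian involution. -/
lemma re_inner_applyQubit_eq_zero {ψ φ : State} (hφ : φ ∈ isospectral ψ)
    (hmin : ∀ χ ∈ isospectral ψ, ‖φ - M4‖ ≤ ‖χ - M4‖) (k : Fin 4)
    {σ : Matrix (Fin 2) (Fin 2) ℂ} (hσ : σ.IsHermitian) (h2 : σ * σ = 1) :
    (inner ℂ (φ - M4) (Complex.I • applyQubit k σ M4)).re = 0 := by
  let U (t : ℝ) : Matrix (Fin 2) (Fin 2) ℂ :=
    (Real.cos t : ℂ) • 1 + ((Real.sin t : ℂ) * Complex.I) • σ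
  have hmem : ∀ t, applyQubit k (U t) φ ∈ isospectral ψ := fun t =>
    applyQubit_mem_isospectral (conjTranspose_mul_rotation hσ h2 t) k hφ
  set a := (inner ℂ M4 φ).re with ha
  set b := (inner ℂ M4 (Complex.I • applyQubit k σ φ)).re with hb
  have hU : ∀ t, (inner ℂ M4 (applyQubit k (U t) φ)).re = Real.cos t * a + Real.sin t * b :=
    fun t => by
      simp only [U]
      rw [applyQubit_add_matrix, applyQubit_smul_matrix, applyQubit_smul_matrix,
        applyQubit_one_matrix, mul_smul, inner_add_right, inner_smul_right, inner_smul_right,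
        Complex.add_re, Complex.re_ofReal_mul, Complex.re_ofReal_mul]
  have hdist : ∀ χ ∈ isospectral ψ, ‖χ - M4‖ ^ 2 = ‖ψ‖ ^ 2 - 2 * (inner ℂ M4 χ).re + 1 :=
    fun χ hχ => by
      rw [norm_sub_sq (𝕜 := ℂ), norm_eq_of_mem_isospectral hχ, norm_M4, inner_re_symm, one_pow]
      rfl
  -- The norm is constant on the class, so the nearest point maximises the real overlap with `M4`;
  -- stationarity at t = 0 then gives b = 0.
  have hle : ∀ t, Real.cos t * a + Real.sin t * b ≤ a := fun t => by
    have h3 := pow_le_pow_left₀ (norm_nonneg _) (hmin _ (hmem t)) 2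
    rw [hdist _ hφ, hdist _ (hmem t), hU] at h3
    linarith
  have hb0 : b = 0 := by
    have hd : HasDerivAt (fun t => Real.cos t * a + Real.sin t * b) b 0 := by
      simpa using ((Real.hasDerivAt_cos 0).mul_const a).fun_add ((Real.hasDerivAt_sin 0).mul_const b)
    refine IsLocalMax.hasDerivAt_eq_zero (Eventually.of_forall fun t => ?_) hd
    simpa using hle t
  -- The operator iσ is skew-adjoint, which moves the generator from φ to `M4`; for χ = `M4` it
  -- gives a quantity equal to its own negative.
  have hskew : ∀ χ : State, (inner ℂ χ (Complex.I • applyQubit k σ M4)).re =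
      -(inner ℂ M4 (Complex.I • applyQubit k σ χ)).re := fun χ => by
    rw [inner_smul_right, inner_smul_right, ← inner_applyQubit k hσ,
      ← inner_conj_symm]
    simp only [Complex.mul_re, Complex.I_re, Complex.I_im, Complex.conj_im, Complex.conj_re]
    ring
  rw [inner_sub_left, Complex.sub_re, hskew φ, ← hb, hb0, neg_zero, zero_sub, neg_eq_zero]
  have := hskew M4
  linarith

lemma herm_eq (t x y z : ℝ) : herm t x y z = (t : ℂ) • herm 1 0 0 0 + (x : ℂ) • herm 0 1 0 0
    + (y : ℂ) • herm 0 0 1 0 + (z : ℂ) • herm 0 0 0 1 := by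
  ext i j
  fin_cases i <;> fin_cases j <;>
    simp [herm, Complex.ext_iff, sub_eq_add_neg]

/-- Normality is real-linear in the generator, and the identity and the Pauli matrices, all
Hermitian involutions, span the Hermitian matrices. -/
lemma sub_mem_normalSpace {ψ φ : State} (hφ : φ ∈ isospectral ψ)
    (hmin : ∀ χ ∈ isospectral ψ, ‖φ - M4‖ ≤ ‖χ - M4‖) : φ - M4 ∈ normalSpace := by
  have hs : herm 1 0 0 0 * herm 1 0 0 0 = 1 ∧ herm 0 1 0 0 * herm 0 1 0 0 = 1 ∧
      herm 0 0 1 0 * herm 0 0 1 0 = 1 ∧ herm 0 0 0 1 * herm 0 0 0 1 = 1 := by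
    refine ⟨?_, ?_, ?_, ?_⟩ <;> ext i j <;> fin_cases i <;> fin_cases j <;>
      simp [herm, Complex.ext_iff]
  intro k t x y z
  have h := fun σ hσ h2 => re_inner_applyQubit_eq_zero hφ hmin k (σ := σ) hσ h2
  have h0 := h _ (herm_isHermitian _ _ _ _) hs.1
  have h1 := h _ (herm_isHermitian _ _ _ _) hs.2.1
  have h2 := h _ (herm_isHermitian _ _ _ _) hs.2.2.1
  have h3 := h _ (herm_isHermitian _ _ _ _) hs.2.2.2
  rw [herm_eq, applyQubit_add_matrix, applyQubit_add_matrix, applyQubit_add_matrix,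
    applyQubit_smul_matrix, applyQubit_smul_matrix, applyQubit_smul_matrix, applyQubit_smul_matrix,
    smul_add, smul_add, smul_add, smul_comm Complex.I, smul_comm Complex.I, smul_comm Complex.I,
    smul_comm Complex.I]
  simp only [inner_add_right, inner_smul_right _ _ (Complex.ofReal _), Complex.add_re,
    Complex.re_ofReal_mul, h0, h1, h2, h3, mul_zero, add_zero]

lemma isLocalMaxOn_E2 : IsLocalMaxOn E2 (Metric.sphere (0 : State) 1) M4 := by
  obtain ⟨r, hr, hle⟩ := exists_E2_le_of_mem_normalSpace
  refine eventually_nhdsWithin_iff.2 ?_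
  filter_upwards [Metric.ball_mem_nhds M4 hr] with ψ hψ hψ1
  have hn : ‖ψ‖ = 1 := by simpa using hψ1
  have hK : IsCompact (isospectral ψ) :=
    Metric.isCompact_of_isClosed_isBounded (isClosed_isospectral ψ)
      (Metric.isBounded_closedBall (x := (0 : State)) (r := 1) |>.subset fun φ hφ => by
        simp [norm_eq_of_mem_isospectral hφ, hn])
  have hself : ψ ∈ isospectral ψ := fun _ => rfl
  obtain ⟨φ, hφ, hmin⟩ := hK.exists_isMinOn ⟨ψ, hself⟩
    (f := fun φ => ‖φ - M4‖) (by fun_prop)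
  have hmin' : ∀ χ ∈ isospectral ψ, ‖φ - M4‖ ≤ ‖χ - M4‖ := fun χ hχ => hmin hχ
  have h := hle (φ - M4) (sub_mem_normalSpace hφ hmin')
    -- ψ itself competes in the minimisation, so φ is at least as close to `M4`.
    ((hmin' ψ hself).trans_lt (mem_ball_iff_norm.1 hψ))
    (by rw [add_sub_cancel, norm_eq_of_mem_isospectral hφ, hn])
  rwa [add_sub_cancel, E2_eq_of_mem_isospectral hφ] at h

end

end FourQubit

end

theorem mainTheorem1 :
    ‖FourQubit.M4‖ = 1 ∧
    (∀ δψ δ2ψ : FourQubit.State,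
      2 * (inner ℂ δψ FourQubit.M4).re = 0 →
      2 * (inner ℂ δ2ψ FourQubit.M4).re + (inner ℂ δψ δψ).re = 0 →
      ¬ FourQubit.IsInfinitesimalLocalUnitary FourQubit.M4 δψ →
      ∃ δ2E : ℝ, δ2E < 0 ∧
        FourQubit.HasVariations FourQubit.E2 FourQubit.M4 δψ δ2ψ 0 δ2E) ∧
    IsLocalMaxOn FourQubit.E2 (Metric.sphere (0 : FourQubit.State) 1) FourQubit.M4 := by
  refine ⟨FourQubit.norm_M4, fun δψ δ2ψ h1 h2 hnot => ?_, FourQubit.isLocalMaxOn_E2⟩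
  refine ⟨FourQubit.hessian δψ / (3 * Real.log 2), div_neg_of_neg_of_pos ?_ ?_,
    FourQubit.hasVariations_E2 h1 h2⟩
  · exact lt_of_le_of_ne (FourQubit.hessian_nonpos δψ) fun h =>
      hnot (FourQubit.isInfinitesimalLocalUnitary_of_hessian_eq_zero h)
  · exact mul_pos (by norm_num) (Real.log_pos (by norm_num))
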